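/- **Setting.** Let $(\mathbf x_i,u_i,c_i)$, $i=1,2,\dots$, be i.i.d. with values in $\mathbb R^p\times\mathbb R\times\mathbb R$, the error $u_i$ being independent of the pair $(\mathbf x_i,c_i)$ of covariates and censoring variable. Let $\beta_0\in\mathbb R^p$ and $y_i=\beta_0'\mathbf x_i+u_i$; one observes $\mathbf x_i$, $y_i^*=\min(y_i,c_i)$ and $\delta_i=I\{y_i\le c_i\}$. Let $F_0$, $G$ and $D$ be the laws of $u_1$, of $\mathbf x_1$ and of the censoring variable $c_1-\beta_0'\mathbf x_1$ of the error $u_1$. For $\beta\in\mathbb R^p$ let $r_i^*(\beta)=y_i^*-\beta'\mathbf x_i$ and let $F^*_{n\beta}$ be the Kaplan–Meier estimator computed from $(r_i^*(\beta),\delta_i)$, $i\le n$; it gives mass $\pi_j$ to the $j$-th observation if $\delta_j=1$, and no mass to censored observations. For $g:\mathbb R\to\mathbb R$ let $$E_{F^*_{n\beta}}[g(u)\mid \mathbf w_i(\beta)]=\begin{cases} g(r_i^*(\beta)) & \text{if }\delta_i=1,\\ \sum_{j\in M_i}\pi_j\,g(r_j^*(\beta))\Big/\sum_{j\in M_i}\pi_j&\text{if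 }\delta_i=0,\end{cases}\qquad M_i=\{j\le n:\delta_j=1,\ r_j^*(\beta)>r_i^*(\beta)\},$$ (read as $0$ if $\delta_i=0$ and $M_i=\emptyset$). Let $\rho:\mathbb R\to[0,\infty)$ satisfy: (P1) $\rho(0)=0$ and $\rho$ is continuous at $0$; (P2) $\rho(-u)=\rho(u)$ for $u>0$; (P3) $\rho$ is nondecreasing on $u>0$; (P4) $\sup_u\rho(u)=a<\infty$, where $a>0$. For $b>0$ define the M-scale $S_n(\beta,\gamma)$ as the solution $s$ of $$\frac1n\sum_{i=1}^n E_{F^*_{n\beta}}\Big[\rho\Big(\frac{u-\gamma'\mathbf x_i}{s}\Big)\,\Big|\,\mathbf w_i(\beta)\Big]=b,$$ precisely as the infimum of all $s>0$ for which the left-hand side is less than $b$. **Theorem 5.** Suppose that * $F_0$ is symmetric about $0$ and has a strictly unimodal density, that is, an even density which is nonincreasing on $(0,\infty)$ and strictly decreasing there as long as it is positive; * $G(\beta'\mathbf x\neq0)>b/a$ for all $\beta\in\mathbb R^p$, $\beta\ne\mathbf 0$; * (R1) with $\tau_F=\inf\{u:F_0(u)=1\}$ and $\tau_D=\inf\{u:D(u)=1\}$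 (in terms of the distribution functions), $\tau_F<\tau_D$, or $\tau_F=\tau_D=\infty$, or $\tau_F=\tau_D$ and $\tau_F$ is a continuity point of $F_0$; * (R2) $F_0$ and $D$ have no jumps in common. Then, almost surely, $\arg\min_{\gamma\in\mathbb R^p} S_n(\beta_0,\gamma)$ is nonempty for all sufficiently large $n$, and every sequence $\gamma_n(\beta_0)$ that belongs to it for all sufficiently large $n$ converges to $\mathbf 0$. -/

import Mathlib

open MeasureTheory ProbabilityTheory Filter Topology Set

noncomputable section

/-- `ρ` is a bounded loss function with supremum `a`: nonnegative, `ρ 0 = 0`, continuous at `0`,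
even, nondecreasing on the positive half line, and `sup ρ = a < ∞`. -/
structure IsBoundedLoss (ρ : ℝ → ℝ) (a : ℝ) : Prop where
  nonneg : ∀ u, 0 ≤ ρ u
  zero : ρ 0 = 0
  continuousAt_zero : ContinuousAt ρ 0
  even : ∀ u, 0 < u → ρ (-u) = ρ u
  mono : MonotoneOn ρ (Ioi 0)
  isLUB : IsLUB (range ρ) a

/-- `μ` is a law on the line that is symmetric about `0` and has a (strictly) unimodal density:
an even density `f` that is nonincreasing on `(0, ∞)` and strictly decreasing there as long as it
is positive.  The support may be bounded and the value at `0` is irrelevant. -/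
def HasSymmetricUnimodalDensity (μ : Measure ℝ) : Prop :=
  ∃ f : ℝ → ℝ, Measurable f ∧ (∀ u, 0 ≤ f u) ∧
    μ = volume.withDensity (fun u => ENNReal.ofReal (f u)) ∧
    (∀ u, f (-u) = f u) ∧ AntitoneOn f (Ioi 0) ∧ StrictAntiOn f {u | 0 < u ∧ 0 < f u}

/-- `τ = inf {t : F t = 1}` for the distribution function `F` of `μ`, equal to `∞` if `F < 1`
everywhere. -/
def upperEndpoint (μ : Measure ℝ) : EReal :=
  sInf ((fun t : ℝ => (t : EReal)) '' {t : ℝ | cdf μ t = 1})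

/-- Either `τ_F < τ_D`, or `τ_F = τ_D = ∞`, or `τ_F = τ_D` is a continuity point of `F`,
where `F` and `D` are the distribution functions of `μF` and `μD`. -/
def EndpointCondition (μF μD : Measure ℝ) : Prop :=
  upperEndpoint μF < upperEndpoint μD ∨
  (upperEndpoint μF = ⊤ ∧ upperEndpoint μD = ⊤) ∨
  (upperEndpoint μF = upperEndpoint μD ∧
    ∃ t : ℝ, upperEndpoint μF = (t : EReal) ∧ ContinuousAt (cdf μF) t)

/-- The two laws have no common atom, that is, the distribution functions have no common jump. -/
def NoCommonJumps (μF μD : Measure ℝ) : Prop :=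
  ∀ t : ℝ, μF {t} = 0 ∨ μD {t} = 0

/-! ### The Kaplan-Meier estimator

The sample of size `n` is `(r i, δ i)`, `i < n`, where `δ i` says that the `i`-th value is not
censored. -/

section KaplanMeier

open Classical in
/-- Number of observations at risk at `v`. -/
def kmAtRisk (n : ℕ) (r : ℕ → ℝ) (v : ℝ) : ℕ :=
  ((Finset.range n).filter (fun k => v ≤ r k)).card

open Classical in
/-- Number of uncensored observations equal to `v`. -/
def kmEvents (n : ℕ) (r : ℕ → ℝ) (δ : ℕ → Prop) (v : ℝ) : ℕ :=
  ((Finset.range n).filter (fun k => δ k ∧ r k = v)).card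

open Classical in
/-- Left limit at `t` of the Kaplan-Meier (product-limit) survival function: the product over the
distinct uncensored values `v < t` of `1 - d(v) / m(v)`, with `d(v)` uncensored observations at `v`
and `m(v)` observations at risk. -/
def kmSurvivalLeft (n : ℕ) (r : ℕ → ℝ) (δ : ℕ → Prop) (t : ℝ) : ℝ :=
  ∏ v ∈ (((Finset.range n).filter (fun k => δ k)).image r).filter (fun v => v < t),
    (1 - (kmEvents n r δ v : ℝ) / (kmAtRisk n r v : ℝ))

open Classical in
/-- Mass that the Kaplan-Meier estimator gives to the `j`-th observation.  The jump at `v` is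
`S(v-) * d(v) / m(v)`, shared equally by the `d(v)` uncensored observations at `v`; censored
observations get no mass. -/
def kmWeight (n : ℕ) (r : ℕ → ℝ) (δ : ℕ → Prop) (j : ℕ) : ℝ :=
  if δ j then kmSurvivalLeft n r δ (r j) / (kmAtRisk n r (r j) : ℝ) else 0

open Classical in
/-- Conditional expectation of `g(u)` under the Kaplan-Meier estimator, given the `i`-th
observation `(r i, δ i)`: it is `g (r i)` if the observation is uncensored, and the mean of `g`
under the Kaplan-Meier estimator restricted to `(r i, ∞)` and normalized if it is censored (`0` if
there is no uncensored value above `r i`). -/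
def kmCondExp (n : ℕ) (r : ℕ → ℝ) (δ : ℕ → Prop) (g : ℝ → ℝ) (i : ℕ) : ℝ :=
  if δ i then g (r i)
  else (∑ j ∈ (Finset.range n).filter (fun j => δ j ∧ r i < r j), kmWeight n r δ j * g (r j)) /
    ∑ j ∈ (Finset.range n).filter (fun j => δ j ∧ r i < r j), kmWeight n r δ j

end KaplanMeier

/-! ### The censored S-regression -/

/-- Censored residuals `y i - β' x i`, where `y i` is the observed (possibly censored) response. -/
def censoredResidual {p : ℕ} (y : ℕ → ℝ) (x : ℕ → EuclideanSpace ℝ (Fin p))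
    (β : EuclideanSpace ℝ (Fin p)) (i : ℕ) : ℝ :=
  y i - inner ℝ β (x i)

/-- `(1/n) ∑ᵢ E[ρ((u - γ' xᵢ) / s) | wᵢ(β)]`, the conditional expectations being taken under the
Kaplan-Meier estimator of the censored residuals from `β`. -/
def meanCensoredLoss {p : ℕ} (ρ : ℝ → ℝ) (n : ℕ) (y : ℕ → ℝ) (x : ℕ → EuclideanSpace ℝ (Fin p))
    (δ : ℕ → Prop) (β γ : EuclideanSpace ℝ (Fin p)) (s : ℝ) : ℝ :=
  (1 / (n : ℝ)) * ∑ i ∈ Finset.range n,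
    kmCondExp n (censoredResidual y x β) δ (fun v => ρ ((v - inner ℝ γ (x i)) / s)) i

/-- The M-scale `S_n(β, γ)`: the root `s` of `meanCensoredLoss … s = b`, in the form
`inf {s > 0 : meanCensoredLoss … s < b}` that makes sense also where a discontinuous or
not strictly increasing `ρ` leaves no root or several. -/
def censoredMScale {p : ℕ} (ρ : ℝ → ℝ) (b : ℝ) (n : ℕ) (y : ℕ → ℝ)
    (x : ℕ → EuclideanSpace ℝ (Fin p)) (δ : ℕ → Prop) (β γ : EuclideanSpace ℝ (Fin p)) : ℝ :=
  sInf {s : ℝ | 0 < s ∧ meanCensoredLoss ρ n y x δ β γ s < b}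

/-- `argmin_γ S_n(β, γ)`: the set of global minimizers of `γ ↦ S_n(β, γ)`. -/
def sRegressionArgmin {p : ℕ} (ρ : ℝ → ℝ) (b : ℝ) (n : ℕ) (y : ℕ → ℝ)
    (x : ℕ → EuclideanSpace ℝ (Fin p)) (δ : ℕ → Prop) (β : EuclideanSpace ℝ (Fin p)) :
    Set (EuclideanSpace ℝ (Fin p)) :=
  {γ | ∀ γ', censoredMScale ρ b n y x δ β γ ≤ censoredMScale ρ b n y x δ β γ'}

/-! ### The model -/

/-- The random elements of the censored linear regression model: the triples `(xᵢ, uᵢ, cᵢ)` of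
covariates, error and censoring variable are i.i.d., and the error is independent of the covariates
and the censoring variable of the same observation, jointly. -/
structure IsCensoredRegressionSample {Ω : Type*} [MeasurableSpace Ω] (P : Measure Ω) {p : ℕ}
    (x : ℕ → Ω → EuclideanSpace ℝ (Fin p)) (u c : ℕ → Ω → ℝ) : Prop where
  measurable_x : ∀ i, Measurable (x i)
  measurable_u : ∀ i, Measurable (u i)
  measurable_c : ∀ i, Measurable (c i)
  indep : iIndepFun (fun i ω => (x i ω, u i ω, c i ω)) P
  identDistrib : ∀ i, IdentDistrib (fun ω => (x i ω, u i ω, c i ω))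
    (fun ω => (x 0 ω, u 0 ω, c 0 ω)) P P
  indep_error : IndepFun (u 0) (fun ω => (x 0 ω, c 0 ω)) P

/-- Response `yᵢ = β₀' xᵢ + uᵢ`. -/
def response {Ω : Type*} {p : ℕ} (β₀ : EuclideanSpace ℝ (Fin p))
    (x : ℕ → Ω → EuclideanSpace ℝ (Fin p)) (u : ℕ → Ω → ℝ) (ω : Ω) (i : ℕ) : ℝ :=
  inner ℝ β₀ (x i ω) + u i ω

/-- Observed response `yᵢ* = min(yᵢ, cᵢ)`. -/
def observedResponse {Ω : Type*} {p : ℕ} (β₀ : EuclideanSpace ℝ (Fin p))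
    (x : ℕ → Ω → EuclideanSpace ℝ (Fin p)) (u c : ℕ → Ω → ℝ) (ω : Ω) (i : ℕ) : ℝ :=
  min (response β₀ x u ω i) (c i ω)

/-- `δᵢ = 1`: the `i`-th response is not censored, `yᵢ ≤ cᵢ`. -/
def isUncensored {Ω : Type*} {p : ℕ} (β₀ : EuclideanSpace ℝ (Fin p))
    (x : ℕ → Ω → EuclideanSpace ℝ (Fin p)) (u c : ℕ → Ω → ℝ) (ω : Ω) (i : ℕ) : Prop :=
  response β₀ x u ω i ≤ c i ω

/-- `γ_n(β) = argmin_γ S_n(β, γ)` for the sample drawn at `ω`. -/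
def sampleArgmin {Ω : Type*} {p : ℕ} (ρ : ℝ → ℝ) (b : ℝ) (β₀ : EuclideanSpace ℝ (Fin p))
    (x : ℕ → Ω → EuclideanSpace ℝ (Fin p)) (u c : ℕ → Ω → ℝ) (n : ℕ) (ω : Ω)
    (β : EuclideanSpace ℝ (Fin p)) : Set (EuclideanSpace ℝ (Fin p)) :=
  sRegressionArgmin ρ b n (observedResponse β₀ x u c ω) (fun i => x i ω)
    (isUncensored β₀ x u c ω) β

end

/-! ### Deterministic properties of the Kaplan-Meier estimator -/

section KaplanMeier

variable {n : ℕ} {r : ℕ → ℝ} {δ : ℕ → Prop}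

theorem kmEvents_le_kmAtRisk (n : ℕ) (r : ℕ → ℝ) (δ : ℕ → Prop) (v : ℝ) :
    kmEvents n r δ v ≤ kmAtRisk n r v := by
  classical
  unfold kmEvents kmAtRisk
  apply Finset.card_le_card
  intro k hk
  simp only [Finset.mem_filter] at hk ⊢
  exact ⟨hk.1, hk.2.2.ge⟩

theorem kmAtRisk_antitone (n : ℕ) (r : ℕ → ℝ) : Antitone (kmAtRisk n r) := by
  classical
  intro s t hst
  unfold kmAtRisk
  apply Finset.card_le_card
  intro k hk
  simp only [Finset.mem_filter] at hk ⊢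
  exact ⟨hk.1, hst.trans hk.2⟩

theorem kmHazard_nonneg (n : ℕ) (r : ℕ → ℝ) (δ : ℕ → Prop) (v : ℝ) :
    0 ≤ 1 - (kmEvents n r δ v : ℝ) / (kmAtRisk n r v : ℝ) := by
  rw [sub_nonneg]
  apply div_le_one_of_le₀ _ (by positivity)
  exact_mod_cast kmEvents_le_kmAtRisk n r δ v

theorem kmHazard_le_one (n : ℕ) (r : ℕ → ℝ) (δ : ℕ → Prop) (v : ℝ) :
    1 - (kmEvents n r δ v : ℝ) / (kmAtRisk n r v : ℝ) ≤ 1 := by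
  have : 0 ≤ (kmEvents n r δ v : ℝ) / (kmAtRisk n r v : ℝ) := by positivity
  linarith

theorem kmSurvivalLeft_nonneg (n : ℕ) (r : ℕ → ℝ) (δ : ℕ → Prop) (t : ℝ) :
    0 ≤ kmSurvivalLeft n r δ t :=
  Finset.prod_nonneg fun v _ => kmHazard_nonneg n r δ v

theorem kmSurvivalLeft_le_one (n : ℕ) (r : ℕ → ℝ) (δ : ℕ → Prop) (t : ℝ) :
    kmSurvivalLeft n r δ t ≤ 1 :=
  Finset.prod_le_one (fun v _ => kmHazard_nonneg n r δ v) fun v _ => kmHazard_le_one n r δ v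

theorem kmSurvivalLeft_antitone (n : ℕ) (r : ℕ → ℝ) (δ : ℕ → Prop) :
    Antitone (kmSurvivalLeft n r δ) := by
  classical
  intro s t hst
  unfold kmSurvivalLeft
  rw [← Finset.prod_sdiff (Finset.monotone_filter_right _ fun v _ hv => lt_of_lt_of_le hv hst)]
  exact mul_le_of_le_one_left (Finset.prod_nonneg fun v _ => kmHazard_nonneg n r δ v)
    (Finset.prod_le_one (fun v _ => kmHazard_nonneg n r δ v) fun v _ => kmHazard_le_one n r δ v)

theorem kmWeight_nonneg (n : ℕ) (r : ℕ → ℝ) (δ : ℕ → Prop) (j : ℕ) : 0 ≤ kmWeight n r δ j := by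
  unfold kmWeight
  split_ifs
  · exact div_nonneg (kmSurvivalLeft_nonneg n r δ _) (by positivity)
  · rfl

open Classical in
/-- The mass that the Kaplan-Meier estimator gives to `(-∞, t)`. -/
theorem sum_kmWeight_lt (n : ℕ) (r : ℕ → ℝ) (δ : ℕ → Prop) (t : ℝ) :
    ∑ j ∈ (Finset.range n).filter (fun j => δ j ∧ r j < t), kmWeight n r δ j
      = 1 - kmSurvivalLeft n r δ t := by
  have h1 := Finset.prod_one_sub_ordered
    ((((Finset.range n).filter (fun k => δ k)).image r).filter (fun v => v < t))
    (fun v => (kmEvents n r δ v : ℝ) / (kmAtRisk n r v : ℝ))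
  have h2 : kmSurvivalLeft n r δ t = _ := h1
  rw [h2, sub_sub_cancel]
  rw [← Finset.sum_fiberwise_of_maps_to (g := r)
    (t := (((Finset.range n).filter (fun k => δ k)).image r).filter (fun v => v < t))]
  · refine Finset.sum_congr rfl fun v hv => ?_
    simp only [Finset.mem_filter] at hv
    have h3 : ∏ w ∈ ((((Finset.range n).filter (fun k => δ k)).image r).filter
        (fun v => v < t)).filter (fun w => w < v),
        (1 - (kmEvents n r δ w : ℝ) / (kmAtRisk n r w : ℝ)) = kmSurvivalLeft n r δ v := by
      unfold kmSurvivalLeft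
      rw [Finset.filter_filter]
      refine Finset.prod_congr (Finset.filter_congr fun w _ => ?_) fun _ _ => rfl
      exact ⟨fun h => h.2, fun h => ⟨h.trans hv.2, h⟩⟩
    rw [h3]
    have h4 : ∀ j ∈ ((Finset.range n).filter (fun j => δ j ∧ r j < t)).filter (fun j => r j = v),
        kmWeight n r δ j = kmSurvivalLeft n r δ v / (kmAtRisk n r v : ℝ) := by
      intro j hj
      simp only [Finset.mem_filter] at hj
      unfold kmWeight
      rw [if_pos hj.1.2.1, hj.2]
    rw [Finset.sum_congr rfl h4, Finset.sum_const, nsmul_eq_mul]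
    have h5 : ((Finset.range n).filter (fun j => δ j ∧ r j < t)).filter (fun j => r j = v)
        = (Finset.range n).filter (fun k => δ k ∧ r k = v) := by
      rw [Finset.filter_filter]
      refine Finset.filter_congr fun w _ => ?_
      constructor
      · exact fun h => ⟨h.1.1, h.2⟩
      · exact fun h => ⟨⟨h.1, h.2 ▸ hv.2⟩, h.2⟩
    rw [h5]
    unfold kmEvents
    ring
  · intro j hj
    simp only [Finset.mem_filter, Finset.mem_image] at hj ⊢
    exact ⟨⟨j, ⟨hj.1, hj.2.1⟩, rfl⟩, hj.2.2⟩

open Classical in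
/-- The mass that the Kaplan-Meier estimator gives to `[s, t)`. -/
theorem sum_kmWeight_Ico (n : ℕ) (r : ℕ → ℝ) (δ : ℕ → Prop) {s t : ℝ} (hst : s ≤ t) :
    ∑ j ∈ (Finset.range n).filter (fun j => δ j ∧ s ≤ r j ∧ r j < t), kmWeight n r δ j
      = kmSurvivalLeft n r δ s - kmSurvivalLeft n r δ t := by
  have h := Finset.sum_filter_add_sum_filter_not
    ((Finset.range n).filter (fun j => δ j ∧ r j < t)) (fun j => r j < s) (kmWeight n r δ)
  rw [Finset.filter_filter, Finset.filter_filter, sum_kmWeight_lt] at h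
  have h1 : (Finset.range n).filter (fun j => (δ j ∧ r j < t) ∧ r j < s)
      = (Finset.range n).filter (fun j => δ j ∧ r j < s) :=
    Finset.filter_congr fun j _ =>
      ⟨fun h => ⟨h.1.1, h.2⟩, fun h => ⟨⟨h.1, h.2.trans_le hst⟩, h.2⟩⟩
  have h2 : (Finset.range n).filter (fun j => (δ j ∧ r j < t) ∧ ¬ r j < s)
      = (Finset.range n).filter (fun j => δ j ∧ s ≤ r j ∧ r j < t) :=
    Finset.filter_congr fun j _ =>
      ⟨fun h => ⟨h.1.1, not_lt.1 h.2, h.1.2⟩, fun h => ⟨⟨h.1, h.2.2⟩, not_lt.2 h.2.1⟩⟩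
  rw [h1, h2, sum_kmWeight_lt] at h
  linarith

open Classical in
/-- The mass that the Kaplan-Meier estimator gives to `(v, ∞)` is at most its survival at `v`. -/
theorem sum_kmWeight_Ioi_le (n : ℕ) (r : ℕ → ℝ) (δ : ℕ → Prop) (v : ℝ) :
    ∑ j ∈ (Finset.range n).filter (fun j => δ j ∧ v < r j), kmWeight n r δ j
      ≤ kmSurvivalLeft n r δ v := by
  obtain ⟨T, hT⟩ : ∃ T : ℝ, v ≤ T ∧ ∀ j ∈ Finset.range n, r j < T := by
    refine ⟨max v (∑ j ∈ Finset.range n, |r j| + 1), le_max_left _ _, fun j hj => ?_⟩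
    refine lt_of_lt_of_le ?_ (le_max_right _ _)
    have := Finset.single_le_sum (f := fun j => |r j|) (fun i _ => abs_nonneg _) hj
    have h2 := le_abs_self (r j)
    linarith
  have h := sum_kmWeight_Ico n r δ hT.1
  have h0 := kmSurvivalLeft_nonneg n r δ T
  calc _ ≤ ∑ j ∈ (Finset.range n).filter (fun j => δ j ∧ v ≤ r j ∧ r j < T), kmWeight n r δ j := by
        apply Finset.sum_le_sum_of_subset_of_nonneg
        · intro j hj
          simp only [Finset.mem_filter] at hj ⊢
          exact ⟨hj.1, hj.2.1, hj.2.2.le, hT.2 j hj.1⟩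
        · exact fun j _ _ => kmWeight_nonneg n r δ j
    _ ≤ _ := by linarith

open Classical in
/-- Number of uncensored observations in `[s, t)`. -/
noncomputable def kmEventsIco (n : ℕ) (r : ℕ → ℝ) (δ : ℕ → Prop) (s t : ℝ) : ℕ :=
  ((Finset.range n).filter (fun k => δ k ∧ s ≤ r k ∧ r k < t)).card

theorem kmSurvivalLeft_sub_le (n : ℕ) (r : ℕ → ℝ) (δ : ℕ → Prop) {s t : ℝ} (hst : s ≤ t)
    (ht : 0 < kmAtRisk n r t) :
    kmSurvivalLeft n r δ s - kmSurvivalLeft n r δ t ≤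
      kmSurvivalLeft n r δ s * (kmEventsIco n r δ s t / kmAtRisk n r t) := by
  classical
  rw [← sum_kmWeight_Ico n r δ hst]
  have h : ∀ j ∈ (Finset.range n).filter (fun j => δ j ∧ s ≤ r j ∧ r j < t),
      kmWeight n r δ j ≤ kmSurvivalLeft n r δ s / kmAtRisk n r t := by
    intro j hj
    simp only [Finset.mem_filter] at hj
    unfold kmWeight
    rw [if_pos hj.2.1]
    apply div_le_div₀ (kmSurvivalLeft_nonneg n r δ s) (kmSurvivalLeft_antitone n r δ hj.2.2.1)
    · exact_mod_cast ht
    · exact_mod_cast kmAtRisk_antitone n r hj.2.2.2.le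
  refine (Finset.sum_le_sum h).trans (le_of_eq ?_)
  rw [Finset.sum_const, nsmul_eq_mul]
  unfold kmEventsIco
  ring

theorem le_kmSurvivalLeft_sub (n : ℕ) (r : ℕ → ℝ) (δ : ℕ → Prop) {s t : ℝ} (hst : s ≤ t)
    (ht : 0 < kmAtRisk n r t) :
    kmSurvivalLeft n r δ t * (kmEventsIco n r δ s t / kmAtRisk n r s) ≤
      kmSurvivalLeft n r δ s - kmSurvivalLeft n r δ t := by
  classical
  rw [← sum_kmWeight_Ico n r δ hst]
  have h : ∀ j ∈ (Finset.range n).filter (fun j => δ j ∧ s ≤ r j ∧ r j < t),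
      kmSurvivalLeft n r δ t / kmAtRisk n r s ≤ kmWeight n r δ j := by
    intro j hj
    simp only [Finset.mem_filter] at hj
    unfold kmWeight
    rw [if_pos hj.2.1]
    apply div_le_div₀ (kmSurvivalLeft_nonneg n r δ _)
      (kmSurvivalLeft_antitone n r δ hj.2.2.2.le)
    · exact_mod_cast ht.trans_le (kmAtRisk_antitone n r hj.2.2.2.le)
    · exact_mod_cast kmAtRisk_antitone n r hj.2.2.1
  refine le_trans (le_of_eq ?_) (Finset.sum_le_sum h)
  rw [Finset.sum_const, nsmul_eq_mul]
  unfold kmEventsIco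
  ring

/-! ### The conditional expectation under the Kaplan-Meier estimator -/

theorem kmCondExp_mono {g g' : ℝ → ℝ} (h : ∀ j < n, g (r j) ≤ g' (r j)) {i : ℕ} (hi : i < n) :
    kmCondExp n r δ g i ≤ kmCondExp n r δ g' i := by
  classical
  unfold kmCondExp
  split_ifs
  · exact h i hi
  · apply div_le_div_of_nonneg_right
    · refine Finset.sum_le_sum fun j hj => ?_
      simp only [Finset.mem_filter, Finset.mem_range] at hj
      exact mul_le_mul_of_nonneg_left (h j hj.1) (kmWeight_nonneg n r δ j)
    · exact Finset.sum_nonneg fun j _ => kmWeight_nonneg n r δ j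

theorem kmCondExp_nonneg {g : ℝ → ℝ} (h : ∀ v, 0 ≤ g v) (i : ℕ) : 0 ≤ kmCondExp n r δ g i := by
  classical
  unfold kmCondExp
  split_ifs
  · exact h _
  · exact div_nonneg (Finset.sum_nonneg fun j _ => mul_nonneg (kmWeight_nonneg n r δ j) (h _))
      (Finset.sum_nonneg fun j _ => kmWeight_nonneg n r δ j)

theorem kmCondExp_add (g g' : ℝ → ℝ) (i : ℕ) :
    kmCondExp n r δ (fun v => g v + g' v) i = kmCondExp n r δ g i + kmCondExp n r δ g' i := by
  classical
  unfold kmCondExp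
  split_ifs
  · rfl
  · simp only [mul_add, Finset.sum_add_distrib, add_div]

theorem kmCondExp_const_mul (k : ℝ) (g : ℝ → ℝ) (i : ℕ) :
    kmCondExp n r δ (fun v => k * g v) i = k * kmCondExp n r δ g i := by
  classical
  unfold kmCondExp
  split_ifs
  · rfl
  · rw [← mul_div_assoc, Finset.mul_sum]
    congr 1
    exact Finset.sum_congr rfl fun _ _ => by ring

theorem kmCondExp_const_le {k : ℝ} (hk : 0 ≤ k) (i : ℕ) :
    kmCondExp n r δ (fun _ => k) i ≤ k := by
  classical
  unfold kmCondExp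
  split_ifs
  · rfl
  · rw [← Finset.sum_mul, mul_comm, mul_div_assoc]
    exact mul_le_of_le_one_right hk (div_self_le_one _)

/-- If the survival function of the Kaplan-Meier estimator is within `ε` of a continuous
nonincreasing function `F` on `(-∞, t]`, the conditional mass of `[s, t)` given a censored
observation below `t` is bounded below by the one that belongs to `F`, up to an error of order `ε`. -/
theorem le_kmCondExp_indicator_Ico {F : ℝ → ℝ} (hFc : Continuous F) (hFa : Antitone F)
    {s t ε : ℝ} (hFt : 0 < F t) (hst : s ≤ t)
    (hS : ∀ v ≤ t, |kmSurvivalLeft n r δ v - F v| ≤ ε) {i : ℕ} (hi : ¬ δ i) (hit : r i < t) :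
    (F (max s (r i)) - F t) / F (r i) - 3 * ε / F t ≤
      kmCondExp n r δ ((Ico s t).indicator 1) i := by
  classical
  unfold kmCondExp
  rw [if_neg hi]
  set W := ∑ j ∈ (Finset.range n).filter (fun j => δ j ∧ r i < r j), kmWeight n r δ j with hW
  set N := ∑ j ∈ (Finset.range n).filter (fun j => δ j ∧ r i < r j),
    kmWeight n r δ j * (Ico s t).indicator 1 (r j) with hN
  have hε : 0 ≤ ε := (abs_nonneg _).trans (hS t le_rfl)
  have hWle : W ≤ F (r i) + ε := by
    have h1 := sum_kmWeight_Ioi_le n r δ (r i)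
    have h2 := abs_le.1 (hS (r i) hit.le)
    linarith
  have hNW : N ≤ W := by
    refine Finset.sum_le_sum fun j _ => mul_le_of_le_one_right (kmWeight_nonneg n r δ j) ?_
    exact indicator_apply_le' (fun _ => le_rfl) fun _ => zero_le_one
  have hN0 : 0 ≤ N := by
    refine Finset.sum_nonneg fun j _ => mul_nonneg (kmWeight_nonneg n r δ j) ?_
    exact indicator_nonneg (fun _ _ => zero_le_one) _
  have hNq : ∀ q, r i < q → s ≤ q → q ≤ t → F q - F t - 2 * ε ≤ N := by
    intro q h1 h2 h3
    have h4 : ∑ j ∈ (Finset.range n).filter (fun j => δ j ∧ q ≤ r j ∧ r j < t), kmWeight n r δ j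
        ≤ N := by
      rw [hN]
      have : ∀ j ∈ (Finset.range n).filter (fun j => δ j ∧ q ≤ r j ∧ r j < t),
          kmWeight n r δ j = kmWeight n r δ j * (Ico s t).indicator 1 (r j) := by
        intro j hj
        simp only [Finset.mem_filter] at hj
        rw [indicator_of_mem (show r j ∈ Ico s t from ⟨h2.trans hj.2.2.1, hj.2.2.2⟩)]
        simp
      rw [Finset.sum_congr rfl this]
      apply Finset.sum_le_sum_of_subset_of_nonneg
      · intro j hj
        simp only [Finset.mem_filter] at hj ⊢
        exact ⟨hj.1, hj.2.1, h1.trans_le hj.2.2.1⟩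
      · exact fun j _ _ => mul_nonneg (kmWeight_nonneg n r δ j)
          (indicator_nonneg (fun _ _ => zero_le_one) _)
    rw [sum_kmWeight_Ico n r δ h3] at h4
    have h5 := abs_le.1 (hS q h3)
    have h6 := abs_le.1 (hS t le_rfl)
    linarith
  have hNA : F (max s (r i)) - F t - 2 * ε ≤ N := by
    rcases lt_or_ge (r i) s with h | h
    · rw [max_eq_left h.le]
      exact hNq s h le_rfl hst
    · rw [max_eq_right h]
      have h1 : Tendsto (fun q => F q - F t - 2 * ε) (𝓝[>] (r i)) (𝓝 (F (r i) - F t - 2 * ε)) :=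
        (((hFc.tendsto (r i)).mono_left nhdsWithin_le_nhds).sub_const _).sub_const _
      refine le_of_tendsto h1 ?_
      filter_upwards [Ioc_mem_nhdsGT hit] with q hq
      exact hNq q hq.1 (h.trans hq.1.le) hq.2
  have hB : F t ≤ F (r i) := hFa hit.le
  have hB0 : 0 < F (r i) := hFt.trans_le hB
  have hAB : F (max s (r i)) ≤ F (r i) := hFa (le_max_right _ _)
  have key : F (max s (r i)) - F t - 3 * ε ≤ N / W * F (r i) := by
    rcases (hN0.trans hNW).eq_or_lt with h | h
    · rw [← h, div_zero, zero_mul]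
      have : N ≤ 0 := h ▸ hNW
      linarith
    · have h1 : N / W ≤ 1 := div_le_one_of_le₀ hNW h.le
      have h2 : N / W * W = N := div_mul_cancel₀ _ h.ne'
      have h3 : 0 ≤ N / W := by positivity
      nlinarith
  have h3 : 3 * ε / F (r i) ≤ 3 * ε / F t := by gcongr
  have h4 : (F (max s (r i)) - F t - 3 * ε) / F (r i) ≤ N / W := by
    rw [div_le_iff₀ hB0]
    exact key
  rw [sub_div] at h4
  linarith

end KaplanMeier

/-! ### Bounded loss functions -/

section Loss

/-- The restriction of a loss function to the positive half line, extended by its value at `0`. -/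
def lossPos (ρ : ℝ → ℝ) (v : ℝ) : ℝ := ρ (max v 0)

namespace IsBoundedLoss

variable {ρ : ℝ → ℝ} {a : ℝ}

theorem le (hρ : IsBoundedLoss ρ a) (u : ℝ) : ρ u ≤ a := hρ.isLUB.1 ⟨u, rfl⟩

theorem lossPos_abs (hρ : IsBoundedLoss ρ a) (u : ℝ) : lossPos ρ |u| = ρ u := by
  unfold lossPos
  rw [max_eq_left (abs_nonneg u)]
  rcases le_or_gt 0 u with h | h
  · rw [abs_of_nonneg h]
  · rw [abs_of_neg h, ← hρ.even (-u) (by linarith), neg_neg]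

theorem lossPos_of_nonpos (hρ : IsBoundedLoss ρ a) {v : ℝ} (hv : v ≤ 0) : lossPos ρ v = 0 := by
  unfold lossPos
  rw [max_eq_right hv, hρ.zero]

theorem lossPos_nonneg (hρ : IsBoundedLoss ρ a) (v : ℝ) : 0 ≤ lossPos ρ v := hρ.nonneg _

theorem lossPos_le (hρ : IsBoundedLoss ρ a) (v : ℝ) : lossPos ρ v ≤ a := hρ.le _

theorem lossPos_mono (hρ : IsBoundedLoss ρ a) : Monotone (lossPos ρ) := by
  intro v w hvw
  rcases le_or_gt v 0 with h | h
  · rw [hρ.lossPos_of_nonpos h]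
    exact hρ.lossPos_nonneg w
  · unfold lossPos
    rw [max_eq_left h.le, max_eq_left (h.le.trans hvw)]
    exact hρ.mono h (h.trans_le hvw) hvw

theorem lossPos_continuousAt_zero (hρ : IsBoundedLoss ρ a) : ContinuousAt (lossPos ρ) 0 := by
  have h : ContinuousAt (fun v : ℝ => max v 0) 0 := by fun_prop
  have h2 : ContinuousAt ρ ((fun v : ℝ => max v 0) 0) := by simpa using hρ.continuousAt_zero
  exact ContinuousAt.comp (f := fun v : ℝ => max v 0) h2 h

theorem exists_lt_lossPos (hρ : IsBoundedLoss ρ a) {k : ℝ} (hk : k < a) :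
    ∃ L : ℝ, 0 < L ∧ ∀ v, L ≤ v → k < lossPos ρ v := by
  obtain ⟨_, ⟨u, rfl⟩, h, -⟩ := hρ.isLUB.exists_between hk
  refine ⟨|u| + 1, by positivity, fun v hv => ?_⟩
  rw [← hρ.lossPos_abs] at h
  exact h.trans_le (hρ.lossPos_mono (by linarith))

end IsBoundedLoss

end Loss

/-! ### The M-scale -/

section MScale

variable {p : ℕ} {ρ : ℝ → ℝ} {a b : ℝ} {n : ℕ} {y : ℕ → ℝ} {x : ℕ → EuclideanSpace ℝ (Fin p)}
  {δ : ℕ → Prop} {β : EuclideanSpace ℝ (Fin p)}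

theorem meanCensoredLoss_le_of_abs_le (hρ : IsBoundedLoss ρ a)
    {γ γ' : EuclideanSpace ℝ (Fin p)} {s s' : ℝ} (hs : 0 < s) (hs' : 0 < s')
    (h : ∀ i < n, ∀ j < n, |censoredResidual y x β j - inner ℝ γ (x i)| / s ≤
      |censoredResidual y x β j - inner ℝ γ' (x i)| / s') :
    meanCensoredLoss ρ n y x δ β γ s ≤ meanCensoredLoss ρ n y x δ β γ' s' := by
  unfold meanCensoredLoss
  refine mul_le_mul_of_nonneg_left (Finset.sum_le_sum fun i hi => ?_) (by positivity)
  rw [Finset.mem_range] at hi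
  refine kmCondExp_mono (fun j hj => ?_) hi
  rw [← hρ.lossPos_abs, ← hρ.lossPos_abs (_ / s'), abs_div, abs_div, abs_of_pos hs,
    abs_of_pos hs']
  exact hρ.lossPos_mono (h i hi j hj)

theorem meanCensoredLoss_anti (hρ : IsBoundedLoss ρ a) (γ : EuclideanSpace ℝ (Fin p)) {s s' : ℝ}
    (hs : 0 < s) (h : s ≤ s') :
    meanCensoredLoss ρ n y x δ β γ s' ≤ meanCensoredLoss ρ n y x δ β γ s :=
  meanCensoredLoss_le_of_abs_le hρ (hs.trans_le h) hs fun i _ j _ => by gcongr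

theorem exists_meanCensoredLoss_lt (hρ : IsBoundedLoss ρ a) (hb : 0 < b)
    (γ : EuclideanSpace ℝ (Fin p)) :
    ∃ s, 0 < s ∧ meanCensoredLoss ρ n y x δ β γ s < b := by
  obtain ⟨η, hη, h⟩ := Metric.continuousAt_iff.1 hρ.continuousAt_zero (b / 2) (by positivity)
  set B := ∑ i ∈ Finset.range n, ∑ j ∈ Finset.range n,
    |censoredResidual y x β j - inner ℝ γ (x i)| with hB
  have hB0 : 0 ≤ B := Finset.sum_nonneg fun i _ => Finset.sum_nonneg fun j _ => abs_nonneg _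
  refine ⟨(B + 1) / η, by positivity, ?_⟩
  have h1 : meanCensoredLoss ρ n y x δ β γ ((B + 1) / η) ≤
      (1 / (n : ℝ)) * ∑ i ∈ Finset.range n, b / 2 := by
    unfold meanCensoredLoss
    refine mul_le_mul_of_nonneg_left (Finset.sum_le_sum fun i hi => ?_) (by positivity)
    refine le_trans (kmCondExp_mono (g' := fun _ => b / 2) (fun j hj => ?_) (Finset.mem_range.1 hi))
      (kmCondExp_const_le (by positivity) i)
    have h2 : |censoredResidual y x β j - inner ℝ γ (x i)| ≤ B := by
      refine le_trans ?_ (Finset.single_le_sum (f := fun i => ∑ j ∈ Finset.range n,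
        |censoredResidual y x β j - inner ℝ γ (x i)|)
        (fun i _ => Finset.sum_nonneg fun j _ => abs_nonneg _) hi)
      exact Finset.single_le_sum (f := fun j => |censoredResidual y x β j - inner ℝ γ (x i)|)
        (fun j _ => abs_nonneg _) (Finset.mem_range.2 hj)
    have h3 := @h ((censoredResidual y x β j - inner ℝ γ (x i)) / ((B + 1) / η)) (by
      rw [Real.dist_eq, sub_zero, abs_div, abs_of_pos (show 0 < (B + 1) / η by positivity),
        div_lt_iff₀ (by positivity), mul_div_cancel₀ _ hη.ne']
      linarith)
    rw [Real.dist_eq, hρ.zero, sub_zero, abs_of_nonneg (hρ.nonneg _)] at h3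
    exact h3.le
  refine h1.trans_lt ?_
  rw [Finset.sum_const, Finset.card_range, nsmul_eq_mul]
  rcases Nat.eq_zero_or_pos n with rfl | hn
  · simpa using hb
  · have : (n : ℝ) ≠ 0 := by positivity
    field_simp
    linarith

theorem censoredMScale_nonneg (γ : EuclideanSpace ℝ (Fin p)) :
    0 ≤ censoredMScale ρ b n y x δ β γ :=
  Real.sInf_nonneg fun _ hs => hs.1.le

theorem bddBelow_censoredMScale_set (γ : EuclideanSpace ℝ (Fin p)) :
    BddBelow {s : ℝ | 0 < s ∧ meanCensoredLoss ρ n y x δ β γ s < b} :=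
  ⟨0, fun _ hs => hs.1.le⟩

theorem censoredMScale_le {γ : EuclideanSpace ℝ (Fin p)} {s : ℝ} (hs : 0 < s)
    (h : meanCensoredLoss ρ n y x δ β γ s < b) : censoredMScale ρ b n y x δ β γ ≤ s :=
  csInf_le (bddBelow_censoredMScale_set γ) ⟨hs, h⟩

theorem le_censoredMScale (hρ : IsBoundedLoss ρ a) (hb : 0 < b)
    {γ : EuclideanSpace ℝ (Fin p)} {s : ℝ}
    (h : b ≤ meanCensoredLoss ρ n y x δ β γ s) : s ≤ censoredMScale ρ b n y x δ β γ := by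
  refine le_csInf (exists_meanCensoredLoss_lt hρ hb γ) fun s' hs' => ?_
  by_contra! hlt
  exact absurd (hs'.2.trans_le h) (not_lt.2 (meanCensoredLoss_anti hρ γ hs'.1 hlt.le))

theorem mul_censoredMScale_le (hρ : IsBoundedLoss ρ a) (hb : 0 < b)
    {γ γ' : EuclideanSpace ℝ (Fin p)} {κ : ℝ} (hκ : 0 < κ)
    (h : ∀ i < n, ∀ j < n, κ * |censoredResidual y x β j - inner ℝ γ (x i)| ≤
      |censoredResidual y x β j - inner ℝ γ' (x i)|) :
    κ * censoredMScale ρ b n y x δ β γ ≤ censoredMScale ρ b n y x δ β γ' := by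
  refine le_csInf (exists_meanCensoredLoss_lt hρ hb γ') fun s hs => ?_
  have h1 : censoredMScale ρ b n y x δ β γ ≤ s / κ := by
    refine censoredMScale_le (div_pos hs.1 hκ) (lt_of_le_of_lt ?_ hs.2)
    refine meanCensoredLoss_le_of_abs_le hρ (div_pos hs.1 hκ) hs.1 fun i hi j hj => ?_
    rw [div_div_eq_mul_div, mul_comm]
    exact div_le_div_of_nonneg_right (h i hi j hj) hs.1.le
  rw [le_div_iff₀ hκ] at h1
  linarith

theorem lowerSemicontinuous_censoredMScale (hρ : IsBoundedLoss ρ a) (hb : 0 < b) :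
    LowerSemicontinuous (censoredMScale ρ b n y x δ β) := by
  intro γ z hz
  rcases lt_or_ge z 0 with h0 | h0
  · exact Eventually.of_forall fun γ' => h0.trans_le (censoredMScale_nonneg γ')
  set S := censoredMScale ρ b n y x δ β γ with hS
  have hS0 : 0 < S := h0.trans_lt hz
  obtain ⟨w, hw1, hw2⟩ := exists_between hz
  have hw0 : 0 < w := h0.trans_lt hw1
  have hκ1 : w / S < 1 := (div_lt_one hS0).2 hw2
  have hκ0 : 0 < w / S := div_pos hw0 hS0
  have key : ∀ᶠ γ' in 𝓝 γ, ∀ i ∈ Finset.range n, ∀ j ∈ Finset.range n,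
      w / S * |censoredResidual y x β j - inner ℝ γ (x i)| ≤
        |censoredResidual y x β j - inner ℝ γ' (x i)| := by
    rw [Filter.eventually_all_finset]
    intro i _
    rw [Filter.eventually_all_finset]
    intro j _
    rcases eq_or_ne (censoredResidual y x β j - inner ℝ γ (x i)) 0 with h | h
    · rw [h, abs_zero, mul_zero]
      exact Eventually.of_forall fun _ => abs_nonneg _
    · have hlt : w / S * |censoredResidual y x β j - inner ℝ γ (x i)| <
          |censoredResidual y x β j - inner ℝ γ (x i)| :=
        mul_lt_of_lt_one_left (abs_pos.2 h) hκ1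
      have hc : Continuous fun γ' : EuclideanSpace ℝ (Fin p) =>
          |censoredResidual y x β j - inner ℝ γ' (x i)| := by fun_prop
      exact (hc.continuousAt.eventually (lt_mem_nhds hlt)).mono fun _ h => h.le
  filter_upwards [key] with γ' hγ'
  have := mul_censoredMScale_le (δ := δ) (b := b) hρ hb hκ0 (fun i hi j hj =>
    hγ' i (Finset.mem_range.2 hi) j (Finset.mem_range.2 hj))
  rw [← hS, div_mul_cancel₀ _ hS0.ne'] at this
  exact hw1.trans_le this

end MScale

/-! ### Survival functions -/

section Survival

/-- The left-continuous survival function `v ↦ μ [v, ∞)`. -/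
noncomputable def survLeft (μ : Measure ℝ) (v : ℝ) : ℝ := μ.real (Ici v)

variable (μ : Measure ℝ)

theorem survLeft_nonneg (v : ℝ) : 0 ≤ survLeft μ v := measureReal_nonneg

variable [IsProbabilityMeasure μ]

theorem survLeft_antitone : Antitone (survLeft μ) :=
  fun _ _ h => measureReal_mono (Ici_subset_Ici.2 h)

theorem survLeft_le_one (v : ℝ) : survLeft μ v ≤ 1 := measureReal_le_one

theorem measureReal_Ico_eq {s t : ℝ} (h : s ≤ t) :
    μ.real (Ico s t) = survLeft μ s - survLeft μ t := by
  unfold survLeft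
  rw [← Ici_sdiff_Ici, measureReal_sdiff (Ici_subset_Ici.2 h) measurableSet_Ici]

theorem tendsto_survLeft_atBot : Tendsto (survLeft μ) atBot (𝓝 1) := by
  have h := tendsto_measure_Ici_atBot μ
  rw [measure_univ] at h
  exact (ENNReal.tendsto_toReal ENNReal.one_ne_top).comp h

variable [NullSingletonClass μ]

theorem survLeft_eq_one_sub_cdf (v : ℝ) : survLeft μ v = 1 - cdf μ v := by
  unfold survLeft
  rw [cdf_eq_real, ← probReal_compl_eq_one_sub measurableSet_Iic, compl_Iic]
  exact measureReal_congr Ioi_ae_eq_Ici.symm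

theorem survLeft_continuous : Continuous (survLeft μ) := by
  have h : Continuous (cdf μ) := by
    rw [continuous_iff_continuousAt]
    intro v
    rw [(monotone_cdf μ).continuousAt_iff_leftLim_eq_rightLim, StieltjesFunction.rightLim_eq]
    have h1 := (cdf μ).measure_singleton v
    rw [measure_cdf, measure_singleton] at h1
    have h2 := ENNReal.ofReal_eq_zero.1 h1.symm
    exact le_antisymm ((monotone_cdf μ).leftLim_le le_rfl) (by linarith)
  rw [show survLeft μ = fun v => 1 - cdf μ v from funext (survLeft_eq_one_sub_cdf μ)]
  fun_prop

theorem tendsto_survLeft_atTop : Tendsto (survLeft μ) atTop (𝓝 0) := by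
  rw [show survLeft μ = fun v => 1 - cdf μ v from funext (survLeft_eq_one_sub_cdf μ)]
  simpa using (tendsto_cdf_atTop μ).const_sub 1

end Survival

/-! ### Averages over the sample -/

namespace IsCensoredRegressionSample

variable {Ω : Type*} [MeasurableSpace Ω] {P : Measure Ω} {p : ℕ}
  {x : ℕ → Ω → EuclideanSpace ℝ (Fin p)} {u d : ℕ → Ω → ℝ}

theorem measurable_triple (h : IsCensoredRegressionSample P x u d) (i : ℕ) :
    Measurable fun ω => (x i ω, u i ω, d i ω) :=
  (h.measurable_x i).prodMk ((h.measurable_u i).prodMk (h.measurable_c i))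

/-- Passing from the censoring variables of the responses to those of the errors. -/
theorem censoring_of_error (h : IsCensoredRegressionSample P x u d)
    (β₀ : EuclideanSpace ℝ (Fin p)) :
    IsCensoredRegressionSample P x u (fun i ω => d i ω - inner ℝ β₀ (x i ω)) := by
  have hm : Measurable fun z : EuclideanSpace ℝ (Fin p) × ℝ × ℝ =>
      (z.1, z.2.1, z.2.2 - inner ℝ β₀ z.1) := by fun_prop
  have hm2 : Measurable fun z : EuclideanSpace ℝ (Fin p) × ℝ =>
      (z.1, z.2 - inner ℝ β₀ z.1) := by fun_prop
  refine ⟨h.measurable_x, h.measurable_u, fun i => ?_, ?_, fun i => ?_, ?_⟩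
  · have h1 := h.measurable_x i
    have h2 := h.measurable_c i
    fun_prop
  · exact h.indep.comp (fun _ z => (z.1, z.2.1, z.2.2 - inner ℝ β₀ z.1)) fun _ => hm
  · exact (h.identDistrib i).comp hm
  · exact h.indep_error.comp measurable_id hm2

theorem measureReal_error_inter (h : IsCensoredRegressionSample P x u d) {A B : Set ℝ}
    (hA : MeasurableSet A) (hB : MeasurableSet B) :
    P.real {ω | u 0 ω ∈ A ∧ d 0 ω ∈ B} = (P.map (u 0)).real A * (P.map (d 0)).real B := by
  have h1 : IndepFun (u 0) (d 0) P := h.indep_error.comp measurable_id measurable_snd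
  rw [map_measureReal_apply (h.measurable_u 0) hA, map_measureReal_apply (h.measurable_c 0) hB]
  unfold Measure.real
  rw [← ENNReal.toReal_mul, ← h1.measure_inter_preimage_eq_mul A B hA hB]
  rfl

variable [IsProbabilityMeasure P]

theorem ae_tendsto_average (h : IsCensoredRegressionSample P x u d)
    {ψ : EuclideanSpace ℝ (Fin p) × ℝ × ℝ → ℝ} (hψ : Measurable ψ) {C : ℝ}
    (hC : ∀ z, |ψ z| ≤ C) :
    ∀ᵐ ω ∂P, Tendsto (fun n : ℕ => (1 / (n : ℝ)) *
      ∑ i ∈ Finset.range n, ψ (x i ω, u i ω, d i ω)) atTop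
      (𝓝 (∫ ω, ψ (x 0 ω, u 0 ω, d 0 ω) ∂P)) := by
  have h1 := strong_law_ae_real (μ := P) (fun i ω => ψ (x i ω, u i ω, d i ω))
    (Integrable.of_bound (hψ.comp (h.measurable_triple 0)).aestronglyMeasurable C
      (ae_of_all _ fun ω => hC _))
    (fun i j hij => (h.indep.indepFun hij).comp hψ hψ)
    (fun i => (h.identDistrib i).comp hψ)
  filter_upwards [h1] with ω hω
  refine hω.congr fun n => ?_
  rw [one_div, div_eq_inv_mul]

open Classical in
theorem ae_tendsto_card_div (h : IsCensoredRegressionSample P x u d)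
    {A : Set (EuclideanSpace ℝ (Fin p) × ℝ × ℝ)} (hA : MeasurableSet A) :
    ∀ᵐ ω ∂P, Tendsto (fun n : ℕ =>
      (((Finset.range n).filter fun i => (x i ω, u i ω, d i ω) ∈ A).card : ℝ) / n) atTop
      (𝓝 (P.real {ω | (x 0 ω, u 0 ω, d 0 ω) ∈ A})) := by
  have h1 := h.ae_tendsto_average (ψ := A.indicator fun _ => 1) (measurable_const.indicator hA) (C := 1)
    (fun z => by
      by_cases hz : z ∈ A
      · simp [hz]
      · simp [hz])
  have h2 : ∫ ω, A.indicator (fun _ => (1 : ℝ)) (x 0 ω, u 0 ω, d 0 ω) ∂P =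
      P.real {ω | (x 0 ω, u 0 ω, d 0 ω) ∈ A} := by
    exact integral_indicator_one (h.measurable_triple 0 hA)
  rw [h2] at h1
  filter_upwards [h1] with ω hω
  refine hω.congr fun n => ?_
  rw [Finset.card_filter, one_div, div_eq_inv_mul]
  push_cast
  simp only [indicator_apply]

/-! ### Consistency of the Kaplan-Meier estimator -/

theorem ae_tendsto_kmAtRisk (h : IsCensoredRegressionSample P x u d) (v : ℝ) :
    ∀ᵐ ω ∂P, Tendsto (fun n : ℕ =>
      (kmAtRisk n (fun i => min (u i ω) (d i ω)) v : ℝ) / n) atTop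
      (𝓝 (survLeft (P.map (u 0)) v * survLeft (P.map (d 0)) v)) := by
  have h1 := h.ae_tendsto_card_div (A := {z | v ≤ z.2.1 ∧ v ≤ z.2.2})
    (by measurability)
  have h2 := h.measureReal_error_inter (measurableSet_Ici (a := v)) (measurableSet_Ici (a := v))
  unfold survLeft
  rw [← h2]
  filter_upwards [h1] with ω hω
  refine hω.congr fun n => ?_
  unfold kmAtRisk
  congr 3
  ext i
  simp

/-- The limiting frequency of the uncensored observations in `[s, t)`, and bounds for it. -/
theorem exists_ae_tendsto_kmEventsIco (h : IsCensoredRegressionSample P x u d) {s t : ℝ}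
    (hst : s ≤ t) :
    ∃ H : ℝ, (survLeft (P.map (u 0)) s - survLeft (P.map (u 0)) t) * survLeft (P.map (d 0)) t ≤ H ∧
      H ≤ (survLeft (P.map (u 0)) s - survLeft (P.map (u 0)) t) * survLeft (P.map (d 0)) s ∧
      ∀ᵐ ω ∂P, Tendsto (fun n : ℕ => (kmEventsIco n (fun i => min (u i ω) (d i ω))
        (fun i => u i ω ≤ d i ω) s t : ℝ) / n) atTop (𝓝 H) := by
  have : IsProbabilityMeasure (P.map (u 0)) :=
    Measure.isProbabilityMeasure_map (h.measurable_u 0).aemeasurable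
  refine ⟨P.real {ω | u 0 ω ∈ Ico s t ∧ u 0 ω ≤ d 0 ω}, ?_, ?_, ?_⟩
  · rw [← measureReal_Ico_eq _ hst, survLeft,
      ← h.measureReal_error_inter measurableSet_Ico measurableSet_Ici]
    exact measureReal_mono fun ω hω => ⟨hω.1, hω.1.2.le.trans hω.2⟩
  · rw [← measureReal_Ico_eq _ hst, survLeft,
      ← h.measureReal_error_inter measurableSet_Ico measurableSet_Ici]
    exact measureReal_mono fun ω hω => ⟨hω.1, hω.1.1.trans hω.2⟩
  · have h1 := h.ae_tendsto_card_div (A := {z | z.2.1 ∈ Ico s t ∧ z.2.1 ≤ z.2.2})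
      (by
        refine MeasurableSet.inter ?_ ?_
        · exact (measurable_fst.comp measurable_snd) measurableSet_Ico
        · exact measurableSet_le (measurable_fst.comp measurable_snd)
            (measurable_snd.comp measurable_snd))
    filter_upwards [h1] with ω hω
    refine hω.congr fun n => ?_
    unfold kmEventsIco
    congr 3
    ext i
    simp only [Finset.mem_filter]
    constructor
    · rintro ⟨h0, ⟨h1, h2⟩, h3⟩
      rw [min_eq_left h3]
      exact ⟨h0, h3, h1, h2⟩
    · rintro ⟨h0, h1, h2⟩
      rw [min_eq_left h1] at h2
      exact ⟨h0, h2, h1⟩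

end IsCensoredRegressionSample

namespace IsCensoredRegressionSample

variable {Ω : Type*} [MeasurableSpace Ω] {P : Measure Ω} {p : ℕ}
  {x : ℕ → Ω → EuclideanSpace ℝ (Fin p)} {u d : ℕ → Ω → ℝ} [IsProbabilityMeasure P]

/-- On a short interval, the ratio of the Kaplan-Meier survival function is that of the true one up
to an error of second order. -/
theorem ae_eventually_abs_kmSurvivalLeft_cross_le (h : IsCensoredRegressionSample P x u d)
    {F D : ℝ → ℝ} (hFdef : F = survLeft (P.map (u 0))) (hDdef : D = survLeft (P.map (d 0)))
    {s t : ℝ} (hst : s ≤ t) (hpos : 0 < F t * D t) :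
    ∀ᵐ ω ∂P, ∀ ε > 0, ∀ᶠ n in atTop,
      |kmSurvivalLeft n (fun i => min (u i ω) (d i ω)) (fun i => u i ω ≤ d i ω) t * F s
        - kmSurvivalLeft n (fun i => min (u i ω) (d i ω)) (fun i => u i ω ≤ d i ω) s * F t| ≤
      (F s - F t) * ((F s - F t) + (D s - D t)) / (F t * D t) + ε := by
  have hPu : IsProbabilityMeasure (P.map (u 0)) :=
    Measure.isProbabilityMeasure_map (h.measurable_u 0).aemeasurable
  have hPd : IsProbabilityMeasure (P.map (d 0)) :=
    Measure.isProbabilityMeasure_map (h.measurable_c 0).aemeasurable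
  obtain ⟨H, hH1, hH2, hN⟩ := h.exists_ae_tendsto_kmEventsIco hst
  have hmt := h.ae_tendsto_kmAtRisk t
  have hms := h.ae_tendsto_kmAtRisk s
  rw [← hFdef, ← hDdef] at hH1 hH2 hmt hms
  have hFt1 : F t ≤ 1 := hFdef ▸ survLeft_le_one _ t
  have hDt1 : D t ≤ 1 := hDdef ▸ survLeft_le_one _ t
  have hFs1 : F s ≤ 1 := hFdef ▸ survLeft_le_one _ s
  have hDs1 : D s ≤ 1 := hDdef ▸ survLeft_le_one _ s
  have hFst : F t ≤ F s := hFdef ▸ survLeft_antitone _ hst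
  have hDst : D t ≤ D s := hDdef ▸ survLeft_antitone _ hst
  have hFt0 : 0 ≤ F t := hFdef ▸ survLeft_nonneg _ t
  have hDt0 : 0 ≤ D t := hDdef ▸ survLeft_nonneg _ t
  have hFt : 0 < F t := lt_of_le_of_ne hFt0 (by rintro h0; rw [← h0] at hpos; simp at hpos)
  have hDt : 0 < D t := lt_of_le_of_ne hDt0 (by rintro h0; rw [← h0] at hpos; simp at hpos)
  have hFs : 0 < F s := hFt.trans_le hFst
  have hDs : 0 < D s := hDt.trans_le hDst
  filter_upwards [hN, hmt, hms] with ω hN hmt hms ε hε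
  set r : ℕ → ℝ := fun i => min (u i ω) (d i ω)
  set δ : ℕ → Prop := fun i => u i ω ≤ d i ω
  have hdiv : ∀ v, Tendsto (fun n : ℕ => (kmAtRisk n r v : ℝ) / n) atTop (𝓝 (F v * D v)) →
      F v * D v ≠ 0 → Tendsto (fun n : ℕ => (kmEventsIco n r δ s t : ℝ) / kmAtRisk n r v) atTop
        (𝓝 (H / (F v * D v))) := by
    intro v hv hv0
    refine (hN.div hv hv0).congr' ?_
    filter_upwards [eventually_gt_atTop 0] with n hn
    exact div_div_div_cancel_right₀ (by positivity) _ _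
  have hA := hdiv t hmt hpos.ne'
  have hB := hdiv s hms (mul_pos hFs hDs).ne'
  have hX : ∀ᶠ n in atTop, (kmEventsIco n r δ s t : ℝ) / kmAtRisk n r t * F s ≤
      (F s - F t) + (F s - F t) * ((F s - F t) + (D s - D t)) / (F t * D t) + ε := by
    refine ((hA.mul_const (F s)).eventually (ge_mem_nhds (lt_add_of_le_of_pos ?_ hε)))
    rw [div_mul_eq_mul_div, ← sub_nonneg]
    have e : F s - F t + (F s - F t) * (F s - F t + (D s - D t)) / (F t * D t)
        - H * F s / (F t * D t) = ((F s - F t) * (F t * D t) +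
          (F s - F t) * (F s - F t + (D s - D t)) - H * F s) / (F t * D t) := by
      field_simp
    rw [e]
    refine div_nonneg ?_ hpos.le
    have h1 : H * F s ≤ (F s - F t) * D s * F s := mul_le_mul_of_nonneg_right hH2 hFs.le
    have h2 : (F s - F t) * (F t * D t + (F s - F t + (D s - D t)) - D s * F s) ≥ 0 := by
      refine mul_nonneg (by linarith) ?_
      nlinarith
    nlinarith
  have hY : ∀ᶠ n in atTop, (F s - F t) - (F s - F t) * (D s - D t) / (F t * D t) - ε / 2 ≤
      (kmEventsIco n r δ s t : ℝ) / kmAtRisk n r s * F s := by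
    refine ((hB.mul_const (F s)).eventually (le_mem_nhds ?_))
    have e : H / (F s * D s) * F s = H / D s := by
      field_simp
    have h1 : (F s - F t) * D t / D s ≤ H / D s := div_le_div_of_nonneg_right hH1 hDs.le
    have h2 : (F s - F t) * (D s - D t) / D s ≤ (F s - F t) * (D s - D t) / (F t * D t) := by
      apply div_le_div_of_nonneg_left (mul_nonneg (by linarith) (by linarith)) hpos
      exact (mul_le_of_le_one_left hDt.le hFt1).trans hDst
    have h3 : (F s - F t) * D t / D s = (F s - F t) - (F s - F t) * (D s - D t) / D s := by
      field_simp
      ring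
    rw [e]
    linarith
  have hZ : ∀ᶠ n in atTop, (kmEventsIco n r δ s t : ℝ) / kmAtRisk n r t * (F s - F t) ≤
      (F s - F t) * (F s - F t) / (F t * D t) + ε / 2 := by
    refine ((hA.mul_const (F s - F t)).eventually
      (ge_mem_nhds (lt_add_of_le_of_pos ?_ (half_pos hε))))
    rw [div_mul_eq_mul_div]
    apply div_le_div_of_nonneg_right _ hpos.le
    refine mul_le_mul_of_nonneg_right (hH2.trans ?_) (by linarith)
    exact mul_le_of_le_one_right (by linarith) hDs1
  have hm : ∀ᶠ n in atTop, 0 < kmAtRisk n r t := by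
    filter_upwards [hmt.eventually (lt_mem_nhds hpos)] with n hn
    by_contra! h0
    rw [Nat.le_zero.1 h0] at hn
    simp at hn
  filter_upwards [hX, hY, hZ, hm] with n hX hY hZ hm
  have h1 := kmSurvivalLeft_sub_le n r δ hst hm
  have h2 := le_kmSurvivalLeft_sub n r δ hst hm
  have hs0 := kmSurvivalLeft_nonneg n r δ s
  have hs1 := kmSurvivalLeft_le_one n r δ s
  have ht0 := kmSurvivalLeft_nonneg n r δ t
  have ht1 := kmSurvivalLeft_le_one n r δ t
  set A := (kmEventsIco n r δ s t : ℝ) / kmAtRisk n r t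
  set B := (kmEventsIco n r δ s t : ℝ) / kmAtRisk n r s
  have hA0 : 0 ≤ A := by positivity
  set S := kmSurvivalLeft n r δ s
  set S' := kmSurvivalLeft n r δ t
  have hQ1 : 0 ≤ (F s - F t) * (D s - D t) / (F t * D t) :=
    div_nonneg (mul_nonneg (by linarith) (by linarith)) hpos.le
  have hQ2 : 0 ≤ (F s - F t) * (F s - F t) / (F t * D t) :=
    div_nonneg (mul_nonneg (by linarith) (by linarith)) hpos.le
  rw [mul_add, add_div] at hX ⊢
  set Q1 := (F s - F t) * (D s - D t) / (F t * D t)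
  set Q2 := (F s - F t) * (F s - F t) / (F t * D t)
  rw [abs_le]
  constructor
  · have h3 : (S - S') * F s ≤ S * A * F s := mul_le_mul_of_nonneg_right h1 hFs.le
    have h4 : S * (A * F s - (F s - F t)) ≤ S * (Q2 + Q1 + ε) :=
      mul_le_mul_of_nonneg_left (by linarith) hs0
    have h5 : S * (Q2 + Q1 + ε) ≤ Q2 + Q1 + ε := mul_le_of_le_one_left (by linarith) hs1
    nlinarith
  · have h3 : S' * B * F s ≤ (S - S') * F s := mul_le_mul_of_nonneg_right h2 hFs.le
    have h4 : S' * ((F s - F t) - B * F s) ≤ S' * (Q1 + ε / 2) :=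
      mul_le_mul_of_nonneg_left (by linarith) ht0
    have h5 : S' * (Q1 + ε / 2) ≤ Q1 + ε / 2 := mul_le_of_le_one_left (by linarith) ht1
    have h6 : (S - S') * (F s - F t) ≤ A * (F s - F t) :=
      mul_le_mul_of_nonneg_right (h1.trans (mul_le_of_le_one_left hA0 hs1)) (by linarith)
    nlinarith

/-- Ratios of the Kaplan-Meier and the true survival function at two points are close: the second
order bound on short intervals, summed over `2 ^ m` intervals of equal probability. -/
theorem ae_eventually_abs_kmSurvivalLeft_div_sub_le (h : IsCensoredRegressionSample P x u d)
    {F D : ℝ → ℝ} (hFdef : F = survLeft (P.map (u 0))) (hDdef : D = survLeft (P.map (d 0)))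
    (hFc : Continuous F) {T : ℝ} (hpos : 0 < F T * D T) (m : ℕ) :
    ∀ s t : ℝ, s ≤ t → t ≤ T → ∀ᵐ ω ∂P, ∀ ε > 0, ∀ᶠ n in atTop,
      |kmSurvivalLeft n (fun i => min (u i ω) (d i ω)) (fun i => u i ω ≤ d i ω) t / F t
        - kmSurvivalLeft n (fun i => min (u i ω) (d i ω)) (fun i => u i ω ≤ d i ω) s / F s| ≤
      (F s - F t) * ((F s - F t) + (D s - D t)) / (F T * D T) ^ 3 / 2 ^ m + ε := by
  have hPu : IsProbabilityMeasure (P.map (u 0)) :=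
    Measure.isProbabilityMeasure_map (h.measurable_u 0).aemeasurable
  have hPd : IsProbabilityMeasure (P.map (d 0)) :=
    Measure.isProbabilityMeasure_map (h.measurable_c 0).aemeasurable
  have hFa : Antitone F := hFdef ▸ survLeft_antitone _
  have hDa : Antitone D := hDdef ▸ survLeft_antitone _
  have hF0 : ∀ v, 0 ≤ F v := hFdef ▸ survLeft_nonneg _
  have hD0 : ∀ v, 0 ≤ D v := hDdef ▸ survLeft_nonneg _
  have hD1 : ∀ v, D v ≤ 1 := hDdef ▸ survLeft_le_one _
  induction m with
  | zero =>
    intro s t hst htT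
    have hTt : F T * D T ≤ F t * D t := mul_le_mul (hFa htT) (hDa htT) (hD0 _) (hF0 _)
    have hTF : F T * D T ≤ F t := (mul_le_of_le_one_right (hF0 T) (hD1 T)).trans (hFa htT)
    have hTF' : F T * D T ≤ F s := hTF.trans (hFa hst)
    have hFt : 0 < F t := hpos.trans_le hTF
    have hFs : 0 < F s := hpos.trans_le hTF'
    have hFst := hFa hst
    have hDst := hDa hst
    set k := F T * D T
    filter_upwards [h.ae_eventually_abs_kmSurvivalLeft_cross_le hFdef hDdef hst
      (hpos.trans_le hTt)] with ω hω ε hε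
    filter_upwards [hω (ε * k ^ 2) (by positivity)] with n hn
    set S := kmSurvivalLeft n (fun i => min (u i ω) (d i ω)) (fun i => u i ω ≤ d i ω) s
    set S' := kmSurvivalLeft n (fun i => min (u i ω) (d i ω)) (fun i => u i ω ≤ d i ω) t
    have e : S' / F t - S / F s = (S' * F s - S * F t) / (F t * F s) := by
      field_simp
    rw [e, abs_div, abs_of_pos (mul_pos hFt hFs), div_le_iff₀ (mul_pos hFt hFs), pow_zero, div_one]
    refine hn.trans ?_
    set R := (F s - F t) * ((F s - F t) + (D s - D t))
    have hR : 0 ≤ R := mul_nonneg (by linarith) (by linarith)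
    have hk2 : k ^ 2 ≤ F t * F s := by
      rw [sq]
      exact mul_le_mul hTF hTF' hpos.le hFt.le
    have h1 : R / (F t * D t) ≤ R / k := div_le_div_of_nonneg_left hR hpos hTt
    have h2 : (R / k ^ 3 + ε) * k ^ 2 ≤ (R / k ^ 3 + ε) * (F t * F s) :=
      mul_le_mul_of_nonneg_left hk2 (by positivity)
    have h3 : (R / k ^ 3 + ε) * k ^ 2 = R / k + ε * k ^ 2 := by
      field_simp
    linarith
  | succ m ih =>
    intro s t hst htT
    obtain ⟨q, hq, hFq⟩ := intermediate_value_Icc' hst hFc.continuousOn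
      (show (F s + F t) / 2 ∈ Icc (F t) (F s) by
        have := hFa hst
        constructor <;> linarith)
    filter_upwards [ih s q hq.1 (hq.2.trans htT), ih q t hq.2 htT] with ω h1 h2 ε hε
    filter_upwards [h1 (ε / 2) (by positivity), h2 (ε / 2) (by positivity)] with n h1 h2
    refine (abs_sub_le _ _ _).trans ((add_le_add h2 h1).trans (le_of_sub_nonneg ?_))
    rw [hFq, pow_succ 2 m]
    have e : (F s - F t) * (F s - F t + (D s - D t)) / (F T * D T) ^ 3 / (2 ^ m * 2) + ε -
        (((F s + F t) / 2 - F t) * ((F s + F t) / 2 - F t + (D q - D t)) / (F T * D T) ^ 3 / 2 ^ m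
          + ε / 2 + ((F s - (F s + F t) / 2) * (F s - (F s + F t) / 2 + (D s - D q)) /
            (F T * D T) ^ 3 / 2 ^ m + ε / 2)) = 0 := by
      ring
    rw [e]

end IsCensoredRegressionSample

theorem one_sub_kmSurvivalLeft_le (n : ℕ) (r : ℕ → ℝ) (δ : ℕ → Prop) {s : ℝ}
    (hs : 0 < kmAtRisk n r s) :
    1 - kmSurvivalLeft n r δ s ≤ n / kmAtRisk n r s - 1 := by
  classical
  have hm : (0 : ℝ) < kmAtRisk n r s := by exact_mod_cast hs
  rw [← sum_kmWeight_lt]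
  have h : ∀ j ∈ (Finset.range n).filter (fun j => δ j ∧ r j < s),
      kmWeight n r δ j ≤ 1 / kmAtRisk n r s := by
    intro j hj
    simp only [Finset.mem_filter] at hj
    unfold kmWeight
    rw [if_pos hj.2.1]
    apply div_le_div₀ zero_le_one (kmSurvivalLeft_le_one n r δ _) hm
    exact_mod_cast kmAtRisk_antitone n r hj.2.2.le
  refine (Finset.sum_le_sum h).trans ?_
  rw [Finset.sum_const, nsmul_eq_mul, mul_one_div, le_sub_iff_add_le, div_add_one hm.ne']
  apply div_le_div_of_nonneg_right _ hm.le
  have h1 : ((Finset.range n).filter (fun j => δ j ∧ r j < s)).card + kmAtRisk n r s ≤ n := by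
    unfold kmAtRisk
    rw [← Finset.card_union_of_disjoint]
    · refine (Finset.card_le_card (Finset.union_subset (Finset.filter_subset _ _)
        (Finset.filter_subset _ _))).trans ?_
      rw [Finset.card_range]
    · rw [Finset.disjoint_filter]
      exact fun j _ h => not_le.2 h.2
  exact_mod_cast h1

namespace IsCensoredRegressionSample

variable {Ω : Type*} [MeasurableSpace Ω] {P : Measure Ω} {p : ℕ}
  {x : ℕ → Ω → EuclideanSpace ℝ (Fin p)} {u d : ℕ → Ω → ℝ} [IsProbabilityMeasure P]

/-- Strong consistency of the Kaplan-Meier estimator at a point. -/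
theorem ae_tendsto_kmSurvivalLeft (h : IsCensoredRegressionSample P x u d)
    {F D : ℝ → ℝ} (hFdef : F = survLeft (P.map (u 0))) (hDdef : D = survLeft (P.map (d 0)))
    (hFc : Continuous F) {t : ℝ} (hpos : 0 < F t * D t) :
    ∀ᵐ ω ∂P, Tendsto (fun n => kmSurvivalLeft n (fun i => min (u i ω) (d i ω))
      (fun i => u i ω ≤ d i ω) t) atTop (𝓝 (F t)) := by
  have hPu : IsProbabilityMeasure (P.map (u 0)) :=
    Measure.isProbabilityMeasure_map (h.measurable_u 0).aemeasurable
  have hPd : IsProbabilityMeasure (P.map (d 0)) :=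
    Measure.isProbabilityMeasure_map (h.measurable_c 0).aemeasurable
  have hF1 : ∀ v, F v ≤ 1 := hFdef ▸ survLeft_le_one _
  have hFt : 0 < F t := lt_of_le_of_ne (hFdef ▸ survLeft_nonneg _ t)
    (by rintro h0; rw [← h0] at hpos; simp at hpos)
  have h1 : ∀ᵐ ω ∂P, ∀ m k : ℕ, -(k : ℝ) ≤ t → ∀ ε > 0, ∀ᶠ n in atTop,
      |kmSurvivalLeft n (fun i => min (u i ω) (d i ω)) (fun i => u i ω ≤ d i ω) t / F t
        - kmSurvivalLeft n (fun i => min (u i ω) (d i ω)) (fun i => u i ω ≤ d i ω) (-(k : ℝ))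
          / F (-(k : ℝ))| ≤
      (F (-(k : ℝ)) - F t) * ((F (-(k : ℝ)) - F t) + (D (-(k : ℝ)) - D t)) /
        (F t * D t) ^ 3 / 2 ^ m + ε := by
    rw [ae_all_iff]
    intro m
    rw [ae_all_iff]
    intro k
    by_cases hk : -(k : ℝ) ≤ t
    · filter_upwards [h.ae_eventually_abs_kmSurvivalLeft_div_sub_le hFdef hDdef hFc hpos m _ _
        hk le_rfl] with ω hω _ using hω
    · exact ae_of_all _ fun ω h => absurd h hk
  have h2 : ∀ᵐ ω ∂P, ∀ k : ℕ, Tendsto (fun n : ℕ =>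
      (kmAtRisk n (fun i => min (u i ω) (d i ω)) (-(k : ℝ)) : ℝ) / n) atTop
      (𝓝 (F (-(k : ℝ)) * D (-(k : ℝ)))) := by
    rw [ae_all_iff]
    intro k
    rw [hFdef, hDdef]
    exact h.ae_tendsto_kmAtRisk _
  filter_upwards [h1, h2] with ω h1 h2
  set r : ℕ → ℝ := fun i => min (u i ω) (d i ω)
  set δ : ℕ → Prop := fun i => u i ω ≤ d i ω
  have hlim : Tendsto (fun n => kmSurvivalLeft n r δ t / F t) atTop (𝓝 1) := by
    rw [Metric.tendsto_atTop']
    intro ε hε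
    have hneg : Tendsto (fun k : ℕ => -(k : ℝ)) atTop atBot :=
      tendsto_neg_atTop_atBot.comp tendsto_natCast_atTop_atTop
    have hFk : Tendsto (fun k : ℕ => F (-(k : ℝ))) atTop (𝓝 1) := by
      rw [hFdef]
      exact (tendsto_survLeft_atBot _).comp hneg
    have hDk : Tendsto (fun k : ℕ => D (-(k : ℝ))) atTop (𝓝 1) := by
      rw [hDdef]
      exact (tendsto_survLeft_atBot _).comp hneg
    have e1 : ∀ᶠ k : ℕ in atTop, (F (-(k : ℝ)))⁻¹ < 1 + ε / 4 := by
      have := hFk.inv₀ one_ne_zero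
      rw [inv_one] at this
      exact this.eventually (gt_mem_nhds (by linarith))
    have e2 : ∀ᶠ k : ℕ in atTop, (F (-(k : ℝ)) * D (-(k : ℝ)))⁻¹ < 1 + ε / 4 := by
      have := (hFk.mul hDk).inv₀ (by norm_num)
      rw [mul_one, inv_one] at this
      exact this.eventually (gt_mem_nhds (by linarith))
    have e3 : ∀ᶠ k : ℕ in atTop, 0 < F (-(k : ℝ)) * D (-(k : ℝ)) := by
      have := hFk.mul hDk
      rw [mul_one] at this
      exact this.eventually (lt_mem_nhds zero_lt_one)
    have e4 : ∀ᶠ k : ℕ in atTop, -(k : ℝ) ≤ t := hneg.eventually (eventually_le_atBot t)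
    obtain ⟨k, e1, e2, e3, e4⟩ := (e1.and (e2.and (e3.and e4))).exists
    set s := -(k : ℝ)
    obtain ⟨m, hm⟩ : ∃ m : ℕ, (F s - F t) * ((F s - F t) + (D s - D t)) /
        (F t * D t) ^ 3 / 2 ^ m < ε / 4 := by
      have : Tendsto (fun m : ℕ => (F s - F t) * ((F s - F t) + (D s - D t)) /
        (F t * D t) ^ 3 / (2 : ℝ) ^ m) atTop (𝓝 0) :=
        tendsto_const_nhds.div_atTop (tendsto_pow_atTop_atTop_of_one_lt one_lt_two)
      exact (this.eventually (gt_mem_nhds (by positivity))).exists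
    have hr : ∀ᶠ n : ℕ in atTop, (n : ℝ) / kmAtRisk n r s < 1 + ε / 4 := by
      have := (h2 k).inv₀ e3.ne'
      refine (this.eventually (gt_mem_nhds e2)).mono fun n hn => ?_
      rwa [inv_div] at hn
    have hr0 : ∀ᶠ n in atTop, 0 < kmAtRisk n r s := by
      filter_upwards [(h2 k).eventually (lt_mem_nhds e3)] with n hn
      by_contra! h0
      rw [Nat.le_zero.1 h0] at hn
      simp at hn
    obtain ⟨N, hN⟩ := eventually_atTop.1 ((h1 m k e4 (ε / 4) (by positivity)).and (hr.and hr0))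
    refine ⟨N, fun n hn => ?_⟩
    obtain ⟨g1, g2, g3⟩ := hN n hn.le
    have g4 := one_sub_kmSurvivalLeft_le n r δ g3
    have g5 := kmSurvivalLeft_le_one n r δ s
    have g6 := kmSurvivalLeft_nonneg n r δ s
    have hFs : 0 < F s := lt_of_le_of_ne (hFdef ▸ survLeft_nonneg _ s)
      (by rintro h0; rw [← h0] at e3; simp at e3)
    have g7 : kmSurvivalLeft n r δ s / F s ≤ (F s)⁻¹ := by
      rw [div_eq_mul_inv]
      exact mul_le_of_le_one_left (by positivity) g5
    have g8 : kmSurvivalLeft n r δ s ≤ kmSurvivalLeft n r δ s / F s := by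
      rw [le_div_iff₀ hFs]
      exact mul_le_of_le_one_right g6 (hF1 s)
    have g9 : |kmSurvivalLeft n r δ s / F s - 1| ≤ ε / 4 := by
      rw [abs_le]
      constructor <;> linarith
    rw [Real.dist_eq]
    have g10 := abs_sub_le (kmSurvivalLeft n r δ t / F t) (kmSurvivalLeft n r δ s / F s) 1
    change |kmSurvivalLeft n r δ t / F t - kmSurvivalLeft n r δ s / F s| ≤ _ at g1
    linarith
  have := hlim.mul_const (F t)
  rw [one_mul] at this
  refine this.congr fun n => ?_
  exact div_mul_cancel₀ _ hFt.ne'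

/-- Strong consistency of the Kaplan-Meier estimator, uniformly on a half line. -/
theorem ae_eventually_forall_abs_kmSurvivalLeft_sub_le (h : IsCensoredRegressionSample P x u d)
    {F D : ℝ → ℝ} (hFdef : F = survLeft (P.map (u 0))) (hDdef : D = survLeft (P.map (d 0)))
    (hFc : Continuous F) {T : ℝ} (hpos : 0 < F T * D T) {ε : ℝ} (hε : 0 < ε) :
    ∀ᵐ ω ∂P, ∀ᶠ n in atTop, ∀ v ≤ T, |kmSurvivalLeft n (fun i => min (u i ω) (d i ω))
      (fun i => u i ω ≤ d i ω) v - F v| ≤ ε := by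
  have hPu : IsProbabilityMeasure (P.map (u 0)) :=
    Measure.isProbabilityMeasure_map (h.measurable_u 0).aemeasurable
  have hPd : IsProbabilityMeasure (P.map (d 0)) :=
    Measure.isProbabilityMeasure_map (h.measurable_c 0).aemeasurable
  have hFa : Antitone F := hFdef ▸ survLeft_antitone _
  have hDa : Antitone D := hDdef ▸ survLeft_antitone _
  have hF0 : ∀ v, 0 ≤ F v := hFdef ▸ survLeft_nonneg _
  have hF1 : ∀ v, F v ≤ 1 := hFdef ▸ survLeft_le_one _
  have hD0 : ∀ v, 0 ≤ D v := hDdef ▸ survLeft_nonneg _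
  have hpos' : ∀ v ≤ T, 0 < F v * D v := fun v hv =>
    hpos.trans_le (mul_le_mul (hFa hv) (hDa hv) (hD0 _) (hF0 _))
  have key : ∀ m : ℕ, ∀ s t : ℝ, s ≤ t → t ≤ T → F s - F t ≤ ε / 2 * 2 ^ m →
      ∀ᵐ ω ∂P, ∀ᶠ n in atTop, ∀ v ∈ Icc s t, |kmSurvivalLeft n (fun i => min (u i ω) (d i ω))
        (fun i => u i ω ≤ d i ω) v - F v| ≤ ε := by
    intro m
    induction m with
    | zero =>
      intro s t hst htT hF
      filter_upwards [h.ae_tendsto_kmSurvivalLeft hFdef hDdef hFc (hpos' s (hst.trans htT)),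
        h.ae_tendsto_kmSurvivalLeft hFdef hDdef hFc (hpos' t htT)] with ω h1 h2
      filter_upwards [h1.eventually (ge_mem_nhds (show F s < F s + ε / 2 by linarith)),
        h2.eventually (le_mem_nhds (show F t - ε / 2 < F t by linarith))] with n h1 h2 v hv
      have h3 := kmSurvivalLeft_antitone n (fun i => min (u i ω) (d i ω))
        (fun i => u i ω ≤ d i ω) hv.1
      have h4 := kmSurvivalLeft_antitone n (fun i => min (u i ω) (d i ω))
        (fun i => u i ω ≤ d i ω) hv.2
      have h5 := hFa hv.1
      have h6 := hFa hv.2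
      rw [abs_le]
      constructor <;> linarith
    | succ m ih =>
      intro s t hst htT hF
      obtain ⟨q, hq, hFq⟩ := intermediate_value_Icc' hst hFc.continuousOn
        (show (F s + F t) / 2 ∈ Icc (F t) (F s) by
          have := hFa hst
          constructor <;> linarith)
      rw [pow_succ] at hF
      filter_upwards [ih s q hq.1 (hq.2.trans htT) (by linarith),
        ih q t hq.2 htT (by linarith)] with ω h1 h2
      filter_upwards [h1, h2] with n h1 h2 v hv
      rcases le_total v q with hvq | hvq
      · exact h1 v ⟨hv.1, hvq⟩
      · exact h2 v ⟨hvq, hv.2⟩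
  obtain ⟨s, hs1, hsT⟩ : ∃ s, 1 - ε / 2 < F s ∧ s ≤ T := by
    have : Tendsto F atBot (𝓝 1) := hFdef ▸ tendsto_survLeft_atBot _
    exact ((this.eventually (lt_mem_nhds (show 1 - ε / 2 < 1 by linarith))).and
      (eventually_le_atBot T)).exists
  obtain ⟨m, hm⟩ : ∃ m : ℕ, F s - F T ≤ ε / 2 * 2 ^ m := by
    have : Tendsto (fun m : ℕ => ε / 2 * (2 : ℝ) ^ m) atTop atTop :=
      (tendsto_pow_atTop_atTop_of_one_lt one_lt_two).const_mul_atTop (by positivity)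
    exact (this.eventually (eventually_ge_atTop _)).exists
  filter_upwards [key m s T hsT le_rfl hm,
    h.ae_tendsto_kmSurvivalLeft hFdef hDdef hFc (hpos' s hsT)] with ω h1 h2
  filter_upwards [h1, h2.eventually (le_mem_nhds (show F s - ε / 2 < F s by linarith))]
    with n h1 h2 v hv
  rcases le_total s v with hsv | hsv
  · exact h1 v ⟨hsv, hv⟩
  · have h3 := kmSurvivalLeft_antitone n (fun i => min (u i ω) (d i ω))
      (fun i => u i ω ≤ d i ω) hsv
    have h4 := kmSurvivalLeft_le_one n (fun i => min (u i ω) (d i ω))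
      (fun i => u i ω ≤ d i ω) v
    have h5 := hFa hsv
    have h6 := hF1 v
    rw [abs_le]
    constructor <;> linarith

end IsCensoredRegressionSample

/-- The limit of the conditional probability of `[s, t)` given the observation with error `u` and
censoring variable `d`, where `F` is the survival function of the error. -/
noncomputable def limitCondProb (F : ℝ → ℝ) (s t u d : ℝ) : ℝ :=
  if u ≤ d then (Ico s t).indicator 1 u else if d < t then (F (max s d) - F t) / F d else 0

theorem measurable_limitCondProb {F : ℝ → ℝ} (hF : Measurable F) (s t : ℝ) :
    Measurable fun z : ℝ × ℝ => limitCondProb F s t z.1 z.2 := by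
  unfold limitCondProb
  refine Measurable.ite (measurableSet_le measurable_fst measurable_snd) ?_ ?_
  · exact (measurable_one.indicator measurableSet_Ico).comp measurable_fst
  · refine Measurable.ite (measurableSet_lt measurable_snd measurable_const) ?_ measurable_const
    have h1 : Measurable fun z : ℝ × ℝ => F (max s z.2) :=
      hF.comp (measurable_const.max measurable_snd)
    exact (h1.sub_const _).div (hF.comp measurable_snd)

theorem limitCondProb_mem_Icc {F : ℝ → ℝ} (hF : Antitone F) {s t : ℝ} (hst : s ≤ t)
    (ht : 0 < F t) (u d : ℝ) : limitCondProb F s t u d ∈ Icc (0 : ℝ) 1 := by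
  unfold limitCondProb
  split_ifs with h1 h2
  · exact ⟨indicator_nonneg (fun _ _ => zero_le_one) _,
      indicator_apply_le' (fun _ => le_rfl) fun _ => zero_le_one⟩
  · have h3 : F t ≤ F (max s d) := hF (max_le hst h2.le)
    have h4 : F (max s d) ≤ F d := hF (le_max_right _ _)
    have h5 : 0 < F d := ht.trans_le (hF h2.le)
    exact ⟨div_nonneg (by linarith) h5.le, div_le_one_of_le₀ (by linarith) h5.le⟩
  · exact ⟨le_rfl, zero_le_one⟩

theorem integral_limitCondProb (μ : Measure ℝ) [IsProbabilityMeasure μ] [NullSingletonClass μ]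
    {s t : ℝ} (hst : s ≤ t) (ht : 0 < survLeft μ t) (d : ℝ) :
    ∫ u, limitCondProb (survLeft μ) s t u d ∂μ = survLeft μ s - survLeft μ t := by
  set F := survLeft μ with hF
  have h1 : (fun u => limitCondProb F s t u d) = fun u => (Ico s t ∩ Iic d).indicator 1 u +
      (Ioi d).indicator (fun _ => if d < t then (F (max s d) - F t) / F d else 0) u := by
    funext u
    unfold limitCondProb
    by_cases h : u ≤ d
    · rw [if_pos h, indicator_of_notMem (s := Ioi d) (by simpa using h), add_zero]
      by_cases h2 : u ∈ Ico s t
      · rw [indicator_of_mem h2, indicator_of_mem (show u ∈ Ico s t ∩ Iic d from ⟨h2, h⟩)]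
      · rw [indicator_of_notMem h2, indicator_of_notMem fun h3 => h2 h3.1]
    · rw [if_neg h, indicator_of_mem (s := Ioi d) (by simpa using h),
        indicator_of_notMem fun h3 => h h3.2, zero_add]
  rw [h1, integral_add (f := (Ico s t ∩ Iic d).indicator 1) ((integrable_const (1 : ℝ)).indicator (measurableSet_Ico.inter
    measurableSet_Iic)) ((integrable_const _).indicator measurableSet_Ioi),
    integral_indicator_one (measurableSet_Ico.inter measurableSet_Iic),
    integral_indicator_const _ measurableSet_Ioi]
  have hFd : μ.real (Ioi d) = F d := measureReal_congr Ioi_ae_eq_Ici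
  rw [hFd, smul_eq_mul]
  split_ifs with hd
  · have hd0 : 0 < F d := ht.trans_le (survLeft_antitone μ hd.le)
    rw [mul_div_cancel₀ _ hd0.ne']
    rcases lt_or_ge d s with h | h
    · rw [max_eq_left h.le]
      have : Ico s t ∩ Iic d = ∅ := by
        ext v
        simp only [mem_inter_iff, mem_Ico, mem_Iic, mem_empty_iff_false, iff_false]
        rintro ⟨⟨h1, -⟩, h2⟩
        linarith
      rw [this, measureReal_empty, zero_add]
    · rw [max_eq_right h]
      have : Ico s t ∩ Iic d = Icc s d := by
        ext v
        simp only [mem_inter_iff, mem_Ico, mem_Iic, mem_Icc]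
        exact ⟨fun h => ⟨h.1.1, h.2⟩, fun h => ⟨⟨h.1, h.2.trans_lt hd⟩, h.2⟩⟩
      rw [this, measureReal_congr Ico_ae_eq_Icc.symm, measureReal_Ico_eq μ h]
      ring
  · have : Ico s t ∩ Iic d = Ico s t :=
      inter_eq_left.2 fun v hv => hv.2.le.trans (not_lt.1 hd)
    rw [this, measureReal_Ico_eq μ hst, mul_zero, add_zero]

namespace IsCensoredRegressionSample

variable {Ω : Type*} [MeasurableSpace Ω] {P : Measure Ω} {p : ℕ}
  {x : ℕ → Ω → EuclideanSpace ℝ (Fin p)} {u d : ℕ → Ω → ℝ} [IsProbabilityMeasure P]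

theorem integral_eq_integral_integral (h : IsCensoredRegressionSample P x u d)
    {ψ : ℝ → EuclideanSpace ℝ (Fin p) → ℝ → ℝ}
    (hψ : Measurable fun z : ℝ × EuclideanSpace ℝ (Fin p) × ℝ => ψ z.1 z.2.1 z.2.2) {C : ℝ}
    (hC : ∀ v w k, |ψ v w k| ≤ C) :
    ∫ ω, ψ (u 0 ω) (x 0 ω) (d 0 ω) ∂P =
      ∫ ω, ∫ v, ψ v (x 0 ω) (d 0 ω) ∂(P.map (u 0)) ∂P := by
  have hPu : IsProbabilityMeasure (P.map (u 0)) :=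
    Measure.isProbabilityMeasure_map (h.measurable_u 0).aemeasurable
  have hm : Measurable fun ω => (x 0 ω, d 0 ω) := (h.measurable_x 0).prodMk (h.measurable_c 0)
  have hPx : IsProbabilityMeasure (P.map fun ω => (x 0 ω, d 0 ω)) :=
    Measure.isProbabilityMeasure_map hm.aemeasurable
  have h1 := (indepFun_iff_map_prod_eq_prod_map_map (h.measurable_u 0).aemeasurable
    hm.aemeasurable).1 h.indep_error
  have h2 : ∫ ω, ψ (u 0 ω) (x 0 ω) (d 0 ω) ∂P = ∫ z : ℝ × EuclideanSpace ℝ (Fin p) × ℝ,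
      ψ z.1 z.2.1 z.2.2 ∂((P.map (u 0)).prod (P.map fun ω => (x 0 ω, d 0 ω))) := by
    rw [← h1, integral_map ((h.measurable_u 0).prodMk hm).aemeasurable hψ.aestronglyMeasurable]
  rw [h2, integral_prod_symm _ (Integrable.of_bound hψ.aestronglyMeasurable C
    (ae_of_all _ fun z => hC _ _ _)), integral_map hm.aemeasurable]
  have h3 : Measurable fun z : (EuclideanSpace ℝ (Fin p) × ℝ) × ℝ => ψ z.2 z.1.1 z.1.2 :=
    hψ.comp measurable_swap
  exact (h3.stronglyMeasurable.integral_prod_right).aestronglyMeasurable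

/-- Asymptotic lower bound for the average conditional probability of `[s, t)`, weighted by a
function of the covariates. -/
theorem ae_eventually_le_average_Ico (h : IsCensoredRegressionSample P x u d)
    [NullSingletonClass (P.map (u 0))] {s t : ℝ} (hst : s ≤ t)
    (hpos : 0 < survLeft (P.map (u 0)) t * survLeft (P.map (d 0)) t)
    {φ : EuclideanSpace ℝ (Fin p) → ℝ} (hφ : Measurable φ) (hφ0 : ∀ w, 0 ≤ φ w) {C : ℝ}
    (hφC : ∀ w, φ w ≤ C) {ε : ℝ} (hε : 0 < ε) :
    ∀ᵐ ω ∂P, ∀ᶠ n : ℕ in atTop,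
      (P.map (u 0)).real (Ico s t) * ∫ ω, φ (x 0 ω) ∂P - ε ≤
      (1 / (n : ℝ)) * ∑ i ∈ Finset.range n, kmCondExp n (fun i => min (u i ω) (d i ω))
        (fun i => u i ω ≤ d i ω) (fun v => φ (x i ω) * (Ico s t).indicator 1 v) i := by
  have hPu : IsProbabilityMeasure (P.map (u 0)) :=
    Measure.isProbabilityMeasure_map (h.measurable_u 0).aemeasurable
  set F := survLeft (P.map (u 0)) with hF
  have hFc : Continuous F := survLeft_continuous _
  have hFa : Antitone F := survLeft_antitone _
  have hFt : 0 < F t := lt_of_le_of_ne (survLeft_nonneg _ t)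
    (by rintro h0; rw [← h0] at hpos; simp at hpos)
  have hC0 : 0 ≤ C := (hφ0 0).trans (hφC 0)
  have hlm := measurable_limitCondProb hFc.measurable s t
  have hψm : Measurable fun z : ℝ × EuclideanSpace ℝ (Fin p) × ℝ =>
      φ z.2.1 * limitCondProb F s t z.1 z.2.2 :=
    (hφ.comp (measurable_fst.comp measurable_snd)).mul
      (hlm.comp (measurable_fst.prodMk (measurable_snd.comp measurable_snd)))
  have hψC : ∀ v w k, |φ w * limitCondProb F s t v k| ≤ C := by
    intro v w k
    obtain ⟨h1, h2⟩ := limitCondProb_mem_Icc hFa hst hFt v k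
    rw [abs_of_nonneg (mul_nonneg (hφ0 w) h1)]
    exact (mul_le_of_le_one_right (hφ0 w) h2).trans (hφC w)
  have hint : ∫ ω, φ (x 0 ω) * limitCondProb F s t (u 0 ω) (d 0 ω) ∂P =
      (P.map (u 0)).real (Ico s t) * ∫ ω, φ (x 0 ω) ∂P := by
    rw [h.integral_eq_integral_integral (ψ := fun v w k => φ w * limitCondProb F s t v k) hψm hψC]
    simp_rw [integral_const_mul]
    rw [measureReal_Ico_eq _ hst, mul_comm, ← integral_mul_const]
    congr 1
    funext ω
    rw [integral_limitCondProb _ hst hFt]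
  have hav := h.ae_tendsto_average (ψ := fun z => φ z.1 * limitCondProb F s t z.2.1 z.2.2)
    (hψm.comp ((measurable_fst.comp measurable_snd).prodMk (measurable_fst.prodMk
      (measurable_snd.comp measurable_snd)))) (fun z => hψC _ _ _)
  simp only [hint] at hav
  obtain ⟨η, hη, hη2⟩ : ∃ η, 0 < η ∧ C * (3 * η / F t) ≤ ε / 2 := by
    refine ⟨ε * F t / (6 * (C + 1)), by positivity, ?_⟩
    have : C * (3 * (ε * F t / (6 * (C + 1))) / F t) = ε / 2 * (C / (C + 1)) := by
      field_simp
      ring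
    rw [this]
    exact mul_le_of_le_one_right (by positivity) (div_le_one_of_le₀ (by linarith) (by linarith))
  filter_upwards [hav, h.ae_eventually_forall_abs_kmSurvivalLeft_sub_le hF rfl hFc hpos hη]
    with ω hav hS
  filter_upwards [hav.eventually (le_mem_nhds (sub_lt_self _ (half_pos hε))), hS,
    eventually_gt_atTop 0] with n hav hS hn
  have hterm : ∀ i ∈ Finset.range n, φ (x i ω) * limitCondProb F s t (u i ω) (d i ω) - ε / 2 ≤
      kmCondExp n (fun i => min (u i ω) (d i ω))
        (fun i => u i ω ≤ d i ω) (fun v => φ (x i ω) * (Ico s t).indicator 1 v) i := by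
    intro i _
    rw [kmCondExp_const_mul]
    have hc : limitCondProb F s t (u i ω) (d i ω) - 3 * η / F t ≤
        kmCondExp n (fun i => min (u i ω) (d i ω)) (fun i => u i ω ≤ d i ω)
          ((Ico s t).indicator 1) i := by
      have hη0 : 0 ≤ 3 * η / F t := by positivity
      unfold limitCondProb
      by_cases hud : u i ω ≤ d i ω
      · unfold kmCondExp
        simp only [if_pos hud, min_eq_left hud]
        linarith
      · rw [if_neg hud]
        split_ifs with hdt
        · have hmin : min (u i ω) (d i ω) = d i ω := min_eq_right (not_le.1 hud).le
          have := le_kmCondExp_indicator_Ico hFc hFa hFt hst hS (i := i) hud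
            (by simpa only [hmin] using hdt)
          simpa only [hmin] using this
        · have := kmCondExp_nonneg (n := n) (r := fun i => min (u i ω) (d i ω))
            (δ := fun i => u i ω ≤ d i ω) (g := (Ico s t).indicator 1)
            (fun v => indicator_nonneg (fun _ _ => zero_le_one) _) i
          linarith
    have h1 := mul_le_mul_of_nonneg_left hc (hφ0 (x i ω))
    have h2 : φ (x i ω) * (3 * η / F t) ≤ C * (3 * η / F t) :=
      mul_le_mul_of_nonneg_right (hφC _) (by positivity)
    rw [mul_sub] at h1
    linarith
  have hsum := mul_le_mul_of_nonneg_left (Finset.sum_le_sum hterm)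
    (show 0 ≤ 1 / (n : ℝ) by positivity)
  rw [Finset.sum_sub_distrib, Finset.sum_const, Finset.card_range, nsmul_eq_mul, mul_sub] at hsum
  have hn' : (n : ℝ) ≠ 0 := by positivity
  rw [← mul_assoc, one_div_mul_cancel hn', one_mul] at hsum
  linarith

end IsCensoredRegressionSample

namespace IsCensoredRegressionSample

variable {Ω : Type*} [MeasurableSpace Ω] {P : Measure Ω} {p : ℕ}
  {x : ℕ → Ω → EuclideanSpace ℝ (Fin p)} {u d : ℕ → Ω → ℝ} [IsProbabilityMeasure P]

/-- Asymptotic lower bound for the average conditional expectation of a function `g` of the error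
and the covariates; `g'` and `g''` are lower envelopes of `g`. -/
theorem ae_eventually_le_average (h : IsCensoredRegressionSample P x u d)
    [NullSingletonClass (P.map (u 0))] {T : ℝ}
    (hpos : 0 < survLeft (P.map (u 0)) T * survLeft (P.map (d 0)) T)
    {g g' g'' : ℝ → EuclideanSpace ℝ (Fin p) → ℝ} {η C : ℝ} (hη : 0 < η)
    (hg' : ∀ v, Measurable (g' v))
    (hg'' : Measurable fun z : ℝ × EuclideanSpace ℝ (Fin p) => g'' z.1 z.2)
    (hg0 : ∀ v w, 0 ≤ g v w) (hg'0 : ∀ v w, 0 ≤ g' v w) (hg''0 : ∀ v w, 0 ≤ g'' v w)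
    (hg'C : ∀ v w, g' v w ≤ C) (hgg' : ∀ v v' w, |v - v'| ≤ η → g' v w ≤ g v' w)
    (hg'g'' : ∀ v v' w, |v - v'| ≤ η → g'' v w ≤ g' v' w)
    {s : ℝ} (hsT : s ≤ T) {ε : ℝ} (hε : 0 < ε) :
    ∀ᵐ ω ∂P, ∀ᶠ n : ℕ in atTop,
      ∫ ω, (Ico s T).indicator (fun v => g'' v (x 0 ω)) (u 0 ω) ∂P - ε ≤
      (1 / (n : ℝ)) * ∑ i ∈ Finset.range n, kmCondExp n (fun i => min (u i ω) (d i ω))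
        (fun i => u i ω ≤ d i ω) (fun v => g v (x i ω)) i := by
  have hPu : IsProbabilityMeasure (P.map (u 0)) :=
    Measure.isProbabilityMeasure_map (h.measurable_u 0).aemeasurable
  have hPd : IsProbabilityMeasure (P.map (d 0)) :=
    Measure.isProbabilityMeasure_map (h.measurable_c 0).aemeasurable
  have hC0 : 0 ≤ C := (hg'0 0 0).trans (hg'C 0 0)
  have hg''C : ∀ v w, g'' v w ≤ C := fun v w => (hg'g'' v v w (by simpa using hη.le)).trans
    (hg'C v w)
  have hindm : ∀ s t : ℝ, Measurable fun z : ℝ × EuclideanSpace ℝ (Fin p) =>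
      (Ico s t).indicator (fun v => g'' v z.2) z.1 := by
    intro s t
    have : (fun z : ℝ × EuclideanSpace ℝ (Fin p) => (Ico s t).indicator (fun v => g'' v z.2) z.1)
        = (Prod.fst ⁻¹' Ico s t).indicator fun z => g'' z.1 z.2 := rfl
    rw [this]
    exact hg''.indicator (measurable_fst measurableSet_Ico)
  have hindC : ∀ s t v w, |(Ico s t).indicator (fun v => g'' v w) v| ≤ C := by
    intro s t v w
    rw [abs_of_nonneg (indicator_nonneg (fun _ _ => hg''0 _ _) _)]
    exact indicator_apply_le' (fun _ => hg''C _ _) fun _ => hC0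
  have hindi : ∀ s t, Integrable (fun ω => (Ico s t).indicator (fun v => g'' v (x 0 ω)) (u 0 ω))
      P := fun s t => Integrable.of_bound
    ((hindm s t).comp ((h.measurable_u 0).prodMk (h.measurable_x 0))).aestronglyMeasurable C
    (ae_of_all _ fun ω => hindC _ _ _ _)
  have key : ∀ m : ℕ, ∀ s t : ℝ, s ≤ t → t ≤ T → t - s ≤ η * 2 ^ m → ∀ ε > 0,
      ∀ᵐ ω ∂P, ∀ᶠ n : ℕ in atTop,
        ∫ ω, (Ico s t).indicator (fun v => g'' v (x 0 ω)) (u 0 ω) ∂P - ε ≤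
        (1 / (n : ℝ)) * ∑ i ∈ Finset.range n, kmCondExp n (fun i => min (u i ω) (d i ω))
          (fun i => u i ω ≤ d i ω) (fun v => (Ico s t).indicator (fun v => g v (x i ω)) v) i := by
    intro m
    induction m with
    | zero =>
      intro s t hst htT hts ε hε
      rw [pow_zero, mul_one] at hts
      have hpos' : 0 < survLeft (P.map (u 0)) t * survLeft (P.map (d 0)) t :=
        hpos.trans_le (mul_le_mul (survLeft_antitone _ htT) (survLeft_antitone _ htT)
          (survLeft_nonneg _ _) (survLeft_nonneg _ _))
      have hle : ∫ ω, (Ico s t).indicator (fun v => g'' v (x 0 ω)) (u 0 ω) ∂P ≤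
          (P.map (u 0)).real (Ico s t) * ∫ ω, g' s (x 0 ω) ∂P := by
        rw [h.integral_eq_integral_integral
          (ψ := fun v w _ => (Ico s t).indicator (fun v => g'' v w) v)
          ((hindm s t).comp (measurable_fst.prodMk (measurable_fst.comp measurable_snd)))
          (fun v w _ => hindC s t v w), ← integral_const_mul]
        refine integral_mono_of_nonneg (ae_of_all _ fun ω => integral_nonneg fun v =>
          indicator_nonneg (fun _ _ => hg''0 _ _) _) ?_ (ae_of_all _ fun ω => ?_)
        · exact (Integrable.of_bound ((hg' s).comp (h.measurable_x 0)).aestronglyMeasurable C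
            (ae_of_all _ fun ω => by
              rw [Function.comp_apply, Real.norm_of_nonneg (hg'0 _ _)]
              exact hg'C _ _)).const_mul _
        · have : ∫ v, (Ico s t).indicator (fun _ => g' s (x 0 ω)) v ∂(P.map (u 0)) =
              (P.map (u 0)).real (Ico s t) * g' s (x 0 ω) := by
            rw [integral_indicator_const _ measurableSet_Ico, smul_eq_mul]
          beta_reduce
          rw [← this]
          refine integral_mono_of_nonneg (ae_of_all _ fun v =>
            indicator_nonneg (fun _ _ => hg''0 _ _) _)
            ((integrable_const _).indicator measurableSet_Ico) (ae_of_all _ fun v => ?_)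
          refine indicator_le_indicator' fun hv => hg'g'' _ _ _ ?_
          rw [abs_of_nonneg (by linarith [hv.1])]
          linarith [hv.2]
      filter_upwards [h.ae_eventually_le_average_Ico hst hpos' (hg' s) (hg'0 s) (hg'C s) hε]
        with ω hω
      filter_upwards [hω] with n hn
      refine (sub_le_sub_right hle ε).trans (hn.trans ?_)
      refine mul_le_mul_of_nonneg_left (Finset.sum_le_sum fun i hi => ?_) (by positivity)
      refine kmCondExp_mono (fun j _ => ?_) (Finset.mem_range.1 hi)
      by_cases hv : min (u j ω) (d j ω) ∈ Ico s t
      · rw [indicator_of_mem hv, indicator_of_mem hv, Pi.one_apply, mul_one]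
        apply hgg'
        rw [abs_sub_comm, abs_of_nonneg (by linarith [hv.1])]
        linarith [hv.2]
      · rw [indicator_of_notMem hv, indicator_of_notMem hv, mul_zero]
    | succ m ih =>
      intro s t hst htT hts ε hε
      rw [pow_succ] at hts
      have hq1 : s ≤ (s + t) / 2 := by linarith
      have hq2 : (s + t) / 2 ≤ t := by linarith
      set q := (s + t) / 2 with hq
      have hsplit : ∀ f : ℝ → ℝ, (Ico s t).indicator f =
          fun v => (Ico s q).indicator f v + (Ico q t).indicator f v := by
        intro f
        rw [← Ico_union_Ico_eq_Ico hq1 hq2, indicator_union_of_disjoint]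
        exact Ico_disjoint_Ico_same
      filter_upwards [ih s q hq1 (hq2.trans htT) (by linarith) (ε / 2) (by positivity),
        ih q t hq2 htT (by linarith) (ε / 2) (by positivity)] with ω h1 h2
      filter_upwards [h1, h2] with n h1 h2
      simp only [hsplit, kmCondExp_add, Finset.sum_add_distrib, mul_add]
      rw [integral_add (hindi _ _) (hindi _ _)]
      linarith
  obtain ⟨m, hm⟩ : ∃ m : ℕ, T - s ≤ η * 2 ^ m := by
    have : Tendsto (fun m : ℕ => η * (2 : ℝ) ^ m) atTop atTop :=
      (tendsto_pow_atTop_atTop_of_one_lt one_lt_two).const_mul_atTop hη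
    exact (this.eventually (eventually_ge_atTop _)).exists
  filter_upwards [key m s T hsT le_rfl hm ε hε] with ω hω
  filter_upwards [hω] with n hn
  refine hn.trans (mul_le_mul_of_nonneg_left (Finset.sum_le_sum fun i hi => ?_) (by positivity))
  exact kmCondExp_mono (fun j _ => indicator_le_self' (fun _ _ => hg0 _ _) _)
    (Finset.mem_range.1 hi)

end IsCensoredRegressionSample

/-! ### Symmetric unimodal densities -/

theorem HasSymmetricUnimodalDensity.nullSingletonClass {μ : Measure ℝ}
    (h : HasSymmetricUnimodalDensity μ) : NullSingletonClass μ := by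
  obtain ⟨f, -, -, rfl, -⟩ := h
  exact ⟨fun v => withDensity_absolutelyContinuous _ _ (measure_singleton v)⟩

/-- The mean of a nondecreasing function `Q` of the distance to `t` is strictly larger for `t ≠ 0`
than for `t = 0`. -/
theorem HasSymmetricUnimodalDensity.integral_abs_lt {μ : Measure ℝ} [IsFiniteMeasure μ]
    (h : HasSymmetricUnimodalDensity μ) {Q : ℝ → ℝ} (hQ : Monotone Q) {C : ℝ}
    (hQC : ∀ v, Q v ≤ C) (hQ0 : ∀ v ≤ 0, Q v = 0) (hQc : ContinuousAt Q 0)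
    (hpos : 0 < ∫ v, Q |v| ∂μ) {t : ℝ} (ht : t ≠ 0) :
    ∫ v, Q |v| ∂μ < ∫ v, Q |v - t| ∂μ := by
  obtain ⟨f, hfm, hf0, hμ, hfe, hfa, hfs⟩ := h
  have hQn : ∀ v, 0 ≤ Q v := fun v => by
    rcases le_total v 0 with hv | hv
    · exact (hQ0 v hv).ge
    · exact (hQ0 0 le_rfl).ge.trans (hQ hv)
  have hfabs : ∀ v, f |v| = f v := fun v => by
    rcases abs_choice v with hv | hv <;> rw [hv]
    exact hfe v
  have hfint : Integrable f := by
    refine ⟨hfm.aestronglyMeasurable, ?_⟩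
    rw [hasFiniteIntegral_iff_ofReal (ae_of_all _ hf0)]
    have : μ univ < ⊤ := measure_lt_top μ univ
    rwa [hμ, withDensity_apply _ MeasurableSet.univ, Measure.restrict_univ] at this
  have hint : ∀ g : ℝ → ℝ, ∫ v, g v ∂μ = ∫ v, f v * g v := by
    intro g
    rw [hμ, integral_withDensity_eq_integral_toReal_smul hfm.ennreal_ofReal
      (ae_of_all _ fun _ => ENNReal.ofReal_lt_top)]
    simp only [ENNReal.toReal_ofReal (hf0 _), smul_eq_mul]
  have hQb : ∀ t, Measurable fun v => Q |v - t| := fun t =>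
    hQ.measurable.comp (measurable_id.sub_const t).abs
  have hQi : ∀ t, Integrable fun v => f v * Q |v - t| := by
    intro t
    refine hfint.mul_bdd (c := C) (hQb t).aestronglyMeasurable (ae_of_all _ fun v => ?_)
    rw [Real.norm_of_nonneg (hQn _)]
    exact hQC _
  have hQi0 : Integrable fun v => f v * Q |v| := by simpa using hQi 0
  obtain ⟨w₀, hw₀, hfw₀, hQw₀⟩ : ∃ w, 0 < w ∧ 0 < f w ∧ 0 < Q w := by
    by_contra! hcon
    have : ∀ v, f v * Q |v| = 0 := by
      intro v
      rcases eq_or_ne v 0 with rfl | hv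
      · rw [abs_zero, hQ0 0 le_rfl, mul_zero]
      · rcases (hf0 v).eq_or_lt with h0 | h0
        · rw [← h0, zero_mul]
        · rw [← hfabs] at h0
          rw [le_antisymm (hcon |v| (abs_pos.2 hv) h0) (hQn _), mul_zero]
    rw [hint] at hpos
    simp [this] at hpos
  have hfpos : ∀ w, 0 < w → w ≤ w₀ → 0 < f w := fun w h1 h2 => hfw₀.trans_le (hfa h1 hw₀ h2)
  obtain ⟨a, b, ha, hab, hb, hjump⟩ : ∃ a b : ℝ, 0 ≤ a ∧ a < b ∧ b ≤ w₀ ∧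
      ∀ w, a < w → w < b → Q w < Q (w + |t|) := by
    have ht' := abs_pos.2 ht
    set A := {w : ℝ | 0 < w ∧ 0 < Q w}
    have hAb : BddBelow A := ⟨0, fun w hw => hw.1.le⟩
    have hAw : w₀ ∈ A := ⟨hw₀, hQw₀⟩
    have hinf0 : 0 ≤ sInf A := Real.sInf_nonneg fun w hw => hw.1.le
    have hgt : ∀ v, sInf A < v → 0 < Q v := by
      intro v hv
      obtain ⟨w, hw, hwv⟩ := exists_lt_of_csInf_lt ⟨_, hAw⟩ hv
      exact hw.2.trans_le (hQ hwv.le)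
    rcases hinf0.eq_or_lt with h0 | h0
    · have h1 : 0 < Q |t| := hgt _ (by rwa [← h0])
      obtain ⟨δ, hδ, hδQ⟩ := Metric.continuousAt_iff.1 hQc _ h1
      refine ⟨0, min δ w₀, le_rfl, lt_min hδ hw₀, min_le_right _ _, fun w hw1 hw2 => ?_⟩
      have h2 := @hδQ w (by
        rw [Real.dist_eq, sub_zero, abs_of_pos hw1]
        exact hw2.trans_le (min_le_left _ _))
      rw [Real.dist_eq, hQ0 0 le_rfl, sub_zero, abs_of_nonneg (hQn _)] at h2
      exact h2.trans_le (hQ (by linarith))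
    · refine ⟨max 0 (sInf A - |t|), sInf A, le_max_left _ _, max_lt h0 (by linarith),
        csInf_le hAb hAw, fun w hw1 hw2 => ?_⟩
      have h1 : Q w = 0 := by
        refine le_antisymm ?_ (hQn w)
        by_contra! h2
        exact absurd (csInf_le hAb ⟨(le_max_left _ _).trans_lt hw1, h2⟩) (not_le.2 hw2)
      rw [h1]
      refine hgt _ ?_
      have := (le_max_right 0 (sInf A - |t|)).trans_lt hw1
      linarith
  -- reflection about `t / 2`
  set Δ : ℝ → ℝ := fun v => Q |v - t| - Q |v| with hΔ
  have hΔi : Integrable fun v => f v * Δ v := by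
    simp only [hΔ, mul_sub]
    exact (hQi t).sub hQi0
  have hrefl : ∫ v, f (t - v) * Δ v = - ∫ v, f v * Δ v := by
    rw [← integral_sub_left_eq_self (fun v => f v * Δ v) volume t, ← integral_neg]
    congr 1
    funext v
    simp only [hΔ]
    rw [show t - v - t = -v by ring, abs_neg, abs_sub_comm t v]
    ring
  have hΔi' : Integrable fun v => f (t - v) * Δ v := by
    have := (hΔi.comp_sub_left t).neg
    refine this.congr (ae_of_all _ fun v => ?_)
    simp only [hΔ, Pi.neg_apply]
    rw [show t - v - t = -v by ring, abs_neg, abs_sub_comm t v]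
    ring
  have hanti : ∀ v w : ℝ, v ≠ 0 → |v| ≤ |w| → f w ≤ f v := by
    intro v w hv hvw
    rw [← hfabs v, ← hfabs w]
    have := abs_pos.2 hv
    exact hfa this (this.trans_le hvw) hvw
  have hnn : ∀ v, v ≠ 0 → v ≠ t → 0 ≤ (f v - f (t - v)) * Δ v := by
    intro v hv hvt
    rcases le_total |v| |t - v| with hle | hle
    · refine mul_nonneg (sub_nonneg.2 (hanti _ _ hv hle)) (sub_nonneg.2 (hQ ?_))
      rwa [abs_sub_comm v t]
    · refine mul_nonneg_of_nonpos_of_nonpos (sub_nonpos.2 (hanti _ _ (sub_ne_zero.2 hvt.symm) hle))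
        (sub_nonpos.2 (hQ ?_))
      rwa [abs_sub_comm v t]
  have hstrict : ∀ v, a < |v| → |v| < b → |v - t| = |v| + |t| →
      (f v - f (t - v)) * Δ v ≠ 0 := by
    intro v h1 h2 h3
    have hv0 : 0 < |v| := ha.trans_lt h1
    have hlt : |v| < |t - v| := by
      rw [abs_sub_comm t v, h3]
      have := abs_pos.2 ht
      linarith
    have hQlt : 0 < Δ v := by
      simp only [hΔ]
      rw [h3, sub_pos]
      exact hjump _ h1 h2
    have hfv : 0 < f |v| := hfpos _ hv0 (h2.le.trans hb)
    have hflt : f |t - v| < f |v| := by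
      rcases (hf0 |t - v|).eq_or_lt with h0 | h0
      · rwa [← h0]
      · exact hfs ⟨hv0, hfv⟩ ⟨hv0.trans hlt, h0⟩ hlt
    rw [hfabs, hfabs] at hflt
    exact (mul_pos (sub_pos.2 hflt) hQlt).ne'
  have hpos2 : 0 < ∫ v, (f v - f (t - v)) * Δ v := by
    rw [integral_pos_iff_support_of_nonneg_ae]
    · rcases lt_or_gt_of_ne ht with ht0 | ht0
      · refine lt_of_lt_of_le ?_ (measure_mono (s := Ioo a b) fun v hv => ?_)
        · rw [Real.volume_Ioo]
          simpa using hab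
        · have hv0 : 0 < v := ha.trans_lt hv.1
          refine hstrict v ?_ ?_ ?_
          · rw [abs_of_pos hv0]; exact hv.1
          · rw [abs_of_pos hv0]; exact hv.2
          · rw [abs_of_pos hv0, abs_of_neg ht0, abs_of_pos (by linarith)]
            ring
      · refine lt_of_lt_of_le ?_ (measure_mono (s := Ioo (-b) (-a)) fun v hv => ?_)
        · rw [Real.volume_Ioo]
          simpa using hab
        · have hv0 : v < 0 := hv.2.trans_le (by linarith)
          refine hstrict v ?_ ?_ ?_
          · rw [abs_of_neg hv0]; linarith [hv.2]
          · rw [abs_of_neg hv0]; linarith [hv.1]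
          · rw [abs_of_neg hv0, abs_of_pos ht0, abs_of_neg (by linarith)]
            ring
    · have h0 : ∀ w : ℝ, ∀ᵐ v : ℝ, v ≠ w := fun w => by
        rw [ae_iff]
        simp
      filter_upwards [h0 0, h0 t] with v h1 h2 using hnn v h1 h2
    · refine (hΔi.sub hΔi').congr (ae_of_all _ fun v => ?_)
      simp only [Pi.sub_apply]
      ring
  have hsub : ∫ v, (f v - f (t - v)) * Δ v = 2 * ∫ v, f v * Δ v := by
    have : (fun v => (f v - f (t - v)) * Δ v) = fun v => f v * Δ v - f (t - v) * Δ v := by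
      funext v
      ring
    rw [this, integral_sub hΔi hΔi', hrefl]
    ring
  have hfin : ∫ v, f v * Δ v = ∫ v, Q |v - t| ∂μ - ∫ v, Q |v| ∂μ := by
    rw [hint, hint, ← integral_sub (hQi t) hQi0]
    simp only [hΔ, mul_sub]
  linarith

theorem EndpointCondition.survLeft_pos {μ ν : Measure ℝ} [IsProbabilityMeasure μ]
    [IsProbabilityMeasure ν] [NullSingletonClass μ] (h : EndpointCondition μ ν) {T : ℝ}
    (hT : 0 < survLeft μ T) : 0 < survLeft ν T := by
  have hle : upperEndpoint μ ≤ upperEndpoint ν := by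
    rcases h with h | h | h
    · exact h.le
    · rw [h.2]; exact le_top
    · exact h.1.le
  by_contra! hcon
  have h0 : ν.real (Ici T) = 0 := le_antisymm hcon (survLeft_nonneg ν T)
  have h1 : cdf ν T = 1 := by
    refine le_antisymm (cdf_le_one ν T) ?_
    rw [cdf_eq_real]
    have h2 : ν.real (Iio T) = 1 := by
      rw [← compl_Ici, probReal_compl_eq_one_sub measurableSet_Ici, h0, sub_zero]
    rw [← h2]
    exact measureReal_mono Iio_subset_Iic_self
  have h2 : upperEndpoint ν ≤ T := sInf_le ⟨T, h1, rfl⟩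
  obtain ⟨T', hT', hF'⟩ : ∃ T', T < T' ∧ 0 < survLeft μ T' := by
    have h3 : ∀ᶠ v in 𝓝[>] T, 0 < survLeft μ v :=
      ((survLeft_continuous μ).tendsto T).mono_left nhdsWithin_le_nhds |>.eventually
        (lt_mem_nhds hT)
    obtain ⟨v, hv1, hv2⟩ := (h3.and self_mem_nhdsWithin).exists
    exact ⟨v, hv2, hv1⟩
  have h4 : (T' : EReal) ≤ upperEndpoint μ := by
    refine le_sInf ?_
    rintro _ ⟨v, hv, rfl⟩
    rw [EReal.coe_le_coe_iff]
    by_contra! hlt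
    have h5 := survLeft_antitone μ hlt.le
    rw [survLeft_eq_one_sub_cdf μ v, show cdf μ v = 1 from hv] at h5
    linarith
  have h6 := EReal.coe_le_coe_iff.1 (h4.trans (hle.trans h2))
  linarith

theorem exists_survLeft_mem_Ioo (μ : Measure ℝ) [IsProbabilityMeasure μ] [NullSingletonClass μ]
    {ε : ℝ} (hε : 0 < ε) : ∃ T, 0 < survLeft μ T ∧ survLeft μ T < ε := by
  have hm : 0 < min ε 1 := lt_min hε zero_lt_one
  obtain ⟨s, hs⟩ := ((tendsto_survLeft_atBot μ).eventually
    (lt_mem_nhds (show min ε 1 / 2 < 1 by linarith [min_le_right ε 1]))).exists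
  obtain ⟨t, ht⟩ := ((tendsto_survLeft_atTop μ).eventually
    (gt_mem_nhds (half_pos hm))).exists
  obtain ⟨T, hT⟩ := mem_range_of_exists_le_of_exists_ge (survLeft_continuous μ)
    ⟨t, ht.le⟩ ⟨s, hs.le⟩
  refine ⟨T, by rw [hT]; exact half_pos hm, ?_⟩
  rw [hT]
  linarith [min_le_left ε 1]

theorem tendsto_integral_mul_comp {Ω : Type*} [MeasurableSpace Ω] {P : Measure Ω}
    [IsFiniteMeasure P] {Q : ℝ → ℝ} (hQ : Measurable Q) {C : ℝ} (hQC : ∀ v, |Q v| ≤ C)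
    {q : ℕ → Ω → ℝ} {q' : Ω → ℝ} (hqm : ∀ k, Measurable (q k))
    (hq : ∀ ω, Tendsto (fun k => q k ω) atTop (𝓝 (q' ω)))
    (hc : ∀ᵐ ω ∂P, ContinuousAt Q (q' ω)) {χ : ℕ → Ω → ℝ} {χ' : Ω → ℝ}
    (hχm : ∀ k, Measurable (χ k)) (hχ1 : ∀ k ω, |χ k ω| ≤ 1)
    (hχ : ∀ ω, Tendsto (fun k => χ k ω) atTop (𝓝 (χ' ω))) :
    Tendsto (fun k => ∫ ω, χ k ω * Q (q k ω) ∂P) atTop (𝓝 (∫ ω, χ' ω * Q (q' ω) ∂P)) := by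
  refine tendsto_integral_of_dominated_convergence (fun _ => C)
    (fun k => ((hχm k).mul (hQ.comp (hqm k))).aestronglyMeasurable) (integrable_const C)
    (fun k => ae_of_all _ fun ω => ?_) ?_
  · rw [Real.norm_eq_abs, abs_mul]
    exact (mul_le_of_le_one_left (abs_nonneg _) (hχ1 k ω)).trans (hQC _)
  · filter_upwards [hc] with ω hω
    exact (hχ ω).mul (hω.tendsto.comp (hq ω))

namespace IsCensoredRegressionSample

variable {Ω : Type*} [MeasurableSpace Ω] {P : Measure Ω} {p : ℕ}
  {x : ℕ → Ω → EuclideanSpace ℝ (Fin p)} {u d : ℕ → Ω → ℝ} {ρ : ℝ → ℝ} {a b : ℝ}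

theorem measurable_residual (h : IsCensoredRegressionSample P x u d)
    (γ : EuclideanSpace ℝ (Fin p)) : Measurable fun ω => u 0 ω - inner ℝ γ (x 0 ω) := by
  have h1 := h.measurable_x 0
  have h2 := h.measurable_u 0
  fun_prop

variable [IsProbabilityMeasure P]

theorem ae_residual_ne (h : IsCensoredRegressionSample P x u d)
    [NullSingletonClass (P.map (u 0))] (γ : EuclideanSpace ℝ (Fin p)) (k : ℝ) :
    ∀ᵐ ω ∂P, u 0 ω - inner ℝ γ (x 0 ω) ≠ k := by
  have hPu : IsProbabilityMeasure (P.map (u 0)) :=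
    Measure.isProbabilityMeasure_map (h.measurable_u 0).aemeasurable
  have h1 : IndepFun (x 0) (u 0) P := (h.indep_error.comp measurable_id measurable_fst).symm
  have h2 := (indepFun_iff_map_prod_eq_prod_map_map (h.measurable_x 0).aemeasurable
    (h.measurable_u 0).aemeasurable).1 h1
  have hm : Measurable fun z : EuclideanSpace ℝ (Fin p) × ℝ => z.2 - inner ℝ γ z.1 := by fun_prop
  have hA : MeasurableSet {z : EuclideanSpace ℝ (Fin p) × ℝ | z.2 - inner ℝ γ z.1 = k} :=
    hm (measurableSet_singleton k)
  rw [ae_iff]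
  simp only [ne_eq, not_not]
  have h3 : P {ω | u 0 ω - inner ℝ γ (x 0 ω) = k} = ((P.map (x 0)).prod (P.map (u 0)))
      {z : EuclideanSpace ℝ (Fin p) × ℝ | z.2 - inner ℝ γ z.1 = k} := by
    rw [← h2, Measure.map_apply ((h.measurable_x 0).prodMk (h.measurable_u 0)) hA]
    rfl
  rw [h3, Measure.measure_prod_null hA]
  refine ae_of_all _ fun w => ?_
  have h4 : Prod.mk w ⁻¹' {z : EuclideanSpace ℝ (Fin p) × ℝ | z.2 - inner ℝ γ z.1 = k} =
      {k + inner ℝ γ w} := by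
    ext v
    simp [sub_eq_iff_eq_add]
  beta_reduce
  rw [h4]
  exact measure_singleton _

theorem ae_continuousAt_lossPos (h : IsCensoredRegressionSample P x u d)
    [NullSingletonClass (P.map (u 0))] (hρ : IsBoundedLoss ρ a)
    (γ : EuclideanSpace ℝ (Fin p)) {s : ℝ} (hs : s ≠ 0) :
    ∀ᵐ ω ∂P, ContinuousAt (lossPos ρ) (|u 0 ω - inner ℝ γ (x 0 ω)| / s) := by
  have hc := hρ.lossPos_mono.countable_not_continuousAt
  have h1 : ∀ᵐ ω ∂P, ∀ k ∈ {v | ¬ ContinuousAt (lossPos ρ) v},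
      |u 0 ω - inner ℝ γ (x 0 ω)| / s ≠ k := by
    rw [ae_ball_iff hc]
    intro k _
    filter_upwards [h.ae_residual_ne γ (k * s), h.ae_residual_ne γ (-(k * s))] with ω h1 h2 h3
    rw [div_eq_iff hs] at h3
    rcases abs_choice (u 0 ω - inner ℝ γ (x 0 ω)) with h4 | h4 <;> rw [h4] at h3
    · exact h1 h3
    · exact h2 (by linarith)
  filter_upwards [h1] with ω hω
  by_contra hcon
  exact hω _ hcon rfl

/-- The limit of the mean loss at `γ` with scale `s`. -/
noncomputable def _root_.expectedLoss (ρ : ℝ → ℝ) (P : Measure Ω)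
    (x : ℕ → Ω → EuclideanSpace ℝ (Fin p)) (u : ℕ → Ω → ℝ) (γ : EuclideanSpace ℝ (Fin p))
    (s : ℝ) : ℝ :=
  ∫ ω, lossPos ρ (|u 0 ω - inner ℝ γ (x 0 ω)| / s) ∂P

theorem integrable_lossPos (hρ : IsBoundedLoss ρ a) {q : Ω → ℝ} (hq : Measurable q) :
    Integrable (fun ω => lossPos ρ (q ω)) P :=
  Integrable.of_bound (hρ.lossPos_mono.measurable.comp hq).aestronglyMeasurable a
    (ae_of_all _ fun ω => by
      rw [Real.norm_of_nonneg (hρ.lossPos_nonneg _)]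
      exact hρ.lossPos_le _)

theorem expectedLoss_anti (h : IsCensoredRegressionSample P x u d) (hρ : IsBoundedLoss ρ a)
    (γ : EuclideanSpace ℝ (Fin p)) {s s' : ℝ} (hs : 0 < s) (hss' : s ≤ s') :
    expectedLoss ρ P x u γ s' ≤ expectedLoss ρ P x u γ s := by
  have hm := (h.measurable_residual γ).abs
  refine integral_mono (integrable_lossPos hρ (hm.div_const _))
    (integrable_lossPos hρ (hm.div_const _)) fun ω => hρ.lossPos_mono ?_
  gcongr

/-- The M-scale of the errors. -/
theorem exists_errorScale (h : IsCensoredRegressionSample P x u d)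
    [NullSingletonClass (P.map (u 0))] (hρ : IsBoundedLoss ρ a) (hb : 0 < b) (hba : b < a) :
    ∃ s₀, 0 < s₀ ∧ b ≤ expectedLoss ρ P x u 0 s₀ ∧ ∀ s, s₀ < s → expectedLoss ρ P x u 0 s < b := by
  have hm := (h.measurable_residual 0).abs
  have hRb : ∀ v, |lossPos ρ v| ≤ a := fun v => by
    rw [abs_of_nonneg (hρ.lossPos_nonneg v)]
    exact hρ.lossPos_le v
  have hk1 : Tendsto (fun k : ℕ => (k : ℝ) + 1) atTop atTop :=
    tendsto_natCast_atTop_atTop.atTop_add tendsto_const_nhds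
  have htop : Tendsto (lossPos ρ) atTop (𝓝 a) := by
    rw [tendsto_order]
    constructor
    · intro k hk
      obtain ⟨L, -, hL⟩ := hρ.exists_lt_lossPos hk
      filter_upwards [eventually_ge_atTop L] with v hv using hL v hv
    · intro k hk
      exact Eventually.of_forall fun v => (hρ.lossPos_le v).trans_lt hk
  have hsmall : Tendsto (fun k : ℕ => expectedLoss ρ P x u 0 ((k : ℝ) + 1)⁻¹) atTop (𝓝 a) := by
    have : a = ∫ _ω, a ∂P := by simp
    rw [this]
    refine tendsto_integral_of_dominated_convergence (fun _ => a)
      (fun k => (hρ.lossPos_mono.measurable.comp (hm.div_const _)).aestronglyMeasurable)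
      (integrable_const a) (fun k => ae_of_all _ fun ω => hRb _) ?_
    filter_upwards [h.ae_residual_ne 0 0] with ω hω
    refine htop.comp ?_
    simp only [div_inv_eq_mul]
    exact hk1.const_mul_atTop (abs_pos.2 hω)
  have hlarge : Tendsto (fun k : ℕ => expectedLoss ρ P x u 0 ((k : ℝ) + 1)) atTop (𝓝 0) := by
    have : (0 : ℝ) = ∫ _ω : Ω, 0 ∂P := by simp
    rw [this]
    refine tendsto_integral_of_dominated_convergence (fun _ => a)
      (fun k => (hρ.lossPos_mono.measurable.comp (hm.div_const _)).aestronglyMeasurable)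
      (integrable_const a) (fun k => ae_of_all _ fun ω => hRb _) (ae_of_all _ fun ω => ?_)
    have h1 := hρ.lossPos_continuousAt_zero.tendsto
    rw [hρ.lossPos_of_nonpos le_rfl] at h1
    exact h1.comp (tendsto_const_nhds.div_atTop hk1)
  set A := {s : ℝ | 0 < s ∧ b ≤ expectedLoss ρ P x u 0 s} with hA
  obtain ⟨k, hk⟩ := (hsmall.eventually (lt_mem_nhds hba)).exists
  have hkA : ((k : ℝ) + 1)⁻¹ ∈ A := ⟨by positivity, hk.le⟩
  obtain ⟨l, hl⟩ := (hlarge.eventually (gt_mem_nhds hb)).exists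
  have hAb : BddAbove A := by
    refine ⟨(l : ℝ) + 1, fun s hs => ?_⟩
    by_contra! hlt
    have := h.expectedLoss_anti hρ 0 (by positivity) hlt.le
    linarith [hs.2]
  have hs0 : 0 < sSup A := hkA.1.trans_le (le_csSup hAb hkA)
  refine ⟨sSup A, hs0, ?_, fun s hs => ?_⟩
  · have hη : Tendsto (fun k : ℕ => sSup A * (1 - 1 / ((k : ℝ) + 2))) atTop
        (𝓝 (sSup A)) := by
      have h1 : Tendsto (fun k : ℕ => 1 / ((k : ℝ) + 2)) atTop (𝓝 0) :=
        tendsto_const_nhds.div_atTop (tendsto_natCast_atTop_atTop.atTop_add tendsto_const_nhds)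
      simpa using (h1.const_sub 1).const_mul (sSup A)
    have hlim := tendsto_integral_mul_comp (P := P) hρ.lossPos_mono.measurable hRb
      (q := fun k ω => |u 0 ω - inner ℝ 0 (x 0 ω)| / (sSup A * (1 - 1 / ((k : ℝ) + 2))))
      (fun k => hm.div_const _) (fun ω => tendsto_const_nhds.div hη hs0.ne')
      (h.ae_continuousAt_lossPos hρ 0 hs0.ne') (χ := fun _ _ => 1) (χ' := fun _ => 1)
      (fun _ => measurable_const) (fun _ _ => by simp) (fun _ => tendsto_const_nhds)
    simp only [one_mul] at hlim
    refine ge_of_tendsto' hlim fun k => ?_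
    have h1 : 0 < 1 / ((k : ℝ) + 2) := by positivity
    have h2 : 1 / ((k : ℝ) + 2) < 1 := by
      rw [div_lt_one (by positivity)]
      have : (0 : ℝ) ≤ k := by positivity
      linarith
    obtain ⟨s, hs, hlt⟩ := exists_lt_of_lt_csSup ⟨_, hkA⟩
      (show sSup A * (1 - 1 / ((k : ℝ) + 2)) < sSup A by nlinarith)
    exact hs.2.trans (h.expectedLoss_anti hρ 0 (mul_pos hs0 (by linarith)) hlt.le)
  · by_contra! hcon
    exact absurd (le_csSup hAb ⟨hs0.trans hs, hcon⟩) (not_le.2 hs)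

/-- The limit of the mean loss is minimized strictly at `0`. -/
theorem expectedLoss_zero_lt (h : IsCensoredRegressionSample P x u d)
    (hF : HasSymmetricUnimodalDensity (P.map (u 0))) (hρ : IsBoundedLoss ρ a) {s : ℝ}
    (hs : 0 < s) (hpos : 0 < expectedLoss ρ P x u 0 s) {γ : EuclideanSpace ℝ (Fin p)}
    (hγ : 0 < (P.map (x 0)).real {v | inner ℝ γ v ≠ 0}) :
    expectedLoss ρ P x u 0 s < expectedLoss ρ P x u γ s := by
  have hPu : IsProbabilityMeasure (P.map (u 0)) :=
    Measure.isProbabilityMeasure_map (h.measurable_u 0).aemeasurable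
  have hRb : ∀ v, |lossPos ρ v| ≤ a := fun v => by
    rw [abs_of_nonneg (hρ.lossPos_nonneg v)]
    exact hρ.lossPos_le v
  set Q : ℝ → ℝ := fun v => lossPos ρ (v / s) with hQdef
  have hQ : Monotone Q := fun v w hvw => hρ.lossPos_mono (by gcongr)
  have hQc : ContinuousAt Q 0 := by
    have h1 : ContinuousAt (fun v : ℝ => v / s) 0 := by fun_prop
    have h2 : ContinuousAt (lossPos ρ) ((fun v : ℝ => v / s) 0) := by
      simpa using hρ.lossPos_continuousAt_zero
    exact ContinuousAt.comp (f := fun v : ℝ => v / s) h2 h1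
  have hform : ∀ γ, expectedLoss ρ P x u γ s =
      ∫ ω, ∫ v, Q |v - inner ℝ γ (x 0 ω)| ∂(P.map (u 0)) ∂P := fun γ =>
    h.integral_eq_integral_integral (ψ := fun v w _ => Q |v - inner ℝ γ w|)
      (hQ.measurable.comp (by fun_prop)) (fun _ _ _ => hRb _)
  have hzero : ∫ v, Q |v| ∂(P.map (u 0)) = expectedLoss ρ P x u 0 s := by
    rw [hform]
    simp
  have hlt : ∀ t : ℝ, t ≠ 0 → ∫ v, Q |v| ∂(P.map (u 0)) < ∫ v, Q |v - t| ∂(P.map (u 0)) :=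
    fun t ht => hF.integral_abs_lt hQ (fun v => hρ.lossPos_le _)
      (fun v hv => hρ.lossPos_of_nonpos (div_nonpos_of_nonpos_of_nonneg hv hs.le)) hQc
      (hzero ▸ hpos) ht
  set J : ℝ → ℝ := fun t => ∫ v, Q |v - t| ∂(P.map (u 0)) with hJ
  have hJm : Measurable J := by
    have : Measurable fun z : ℝ × ℝ => Q |z.2 - z.1| := hQ.measurable.comp (by fun_prop)
    exact this.stronglyMeasurable.integral_prod_right.measurable
  have hJb : ∀ t, ‖J t‖ ≤ a := fun t => by
    refine (norm_integral_le_of_norm_le_const (C := a) (ae_of_all _ fun v => hRb _)).trans ?_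
    simp
  have hγm : Measurable fun ω => inner ℝ γ (x 0 ω) := by
    have := h.measurable_x 0
    fun_prop
  have hJi : Integrable (fun ω => J (inner ℝ γ (x 0 ω))) P :=
    Integrable.of_bound (hJm.comp hγm).aestronglyMeasurable a (ae_of_all _ fun _ => hJb _)
  have hJ0 : J 0 = expectedLoss ρ P x u 0 s := by
    rw [← hzero]
    simp [hJ]
  have hJle : ∀ t, J 0 ≤ J t := fun t => by
    rcases eq_or_ne t 0 with rfl | ht
    · exact le_rfl
    · rw [hJ0, ← hzero]
      exact (hlt t ht).le
  have hdiff : 0 < ∫ ω, (J (inner ℝ γ (x 0 ω)) - J 0) ∂P := by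
    rw [integral_pos_iff_support_of_nonneg (fun ω => sub_nonneg.2 (hJle _))
      (hJi.sub (integrable_const _))]
    have h1 : {ω | inner ℝ γ (x 0 ω) ≠ 0} ⊆
        Function.support fun ω => J (inner ℝ γ (x 0 ω)) - J 0 := by
      intro ω hω
      rw [Function.mem_support]
      have := hlt _ hω
      rw [hzero, ← hJ0] at this
      exact (sub_pos.2 this).ne'
    refine lt_of_lt_of_le ?_ (measure_mono h1)
    have hA : MeasurableSet {v : EuclideanSpace ℝ (Fin p) | inner ℝ γ v ≠ 0} := by
      have : Measurable fun v : EuclideanSpace ℝ (Fin p) => inner ℝ γ v := by fun_prop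
      exact this (measurableSet_singleton 0).compl
    rw [map_measureReal_apply (h.measurable_x 0) hA] at hγ
    exact (ENNReal.toReal_pos_iff.1 hγ).1
  rw [integral_sub hJi (integrable_const _), integral_const, probReal_univ, one_smul, hJ0] at hdiff
  rw [hform γ]
  linarith

end IsCensoredRegressionSample

/-! ### The mean loss at the true parameter -/

section ErrorLoss

variable {p : ℕ} {ρ : ℝ → ℝ} {a : ℝ}

/-- The mean censored loss in terms of the errors `u` and their censoring variables `d`. -/
noncomputable def meanErrorLoss (ρ : ℝ → ℝ) (n : ℕ) (x : ℕ → EuclideanSpace ℝ (Fin p))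
    (u d : ℕ → ℝ) (γ : EuclideanSpace ℝ (Fin p)) (s : ℝ) : ℝ :=
  (1 / (n : ℝ)) * ∑ i ∈ Finset.range n, kmCondExp n (fun i => min (u i) (d i))
    (fun i => u i ≤ d i) (fun v => ρ ((v - inner ℝ γ (x i)) / s)) i

theorem meanErrorLoss_anti (hρ : IsBoundedLoss ρ a) {n : ℕ} {x : ℕ → EuclideanSpace ℝ (Fin p)}
    {u d : ℕ → ℝ} (γ : EuclideanSpace ℝ (Fin p)) {s s' : ℝ} (hs : 0 < s) (hss' : s ≤ s') :
    meanErrorLoss ρ n x u d γ s' ≤ meanErrorLoss ρ n x u d γ s := by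
  refine mul_le_mul_of_nonneg_left (Finset.sum_le_sum fun i hi => ?_) (by positivity)
  refine kmCondExp_mono (fun j _ => ?_) (Finset.mem_range.1 hi)
  rw [← hρ.lossPos_abs, ← hρ.lossPos_abs (_ / s), abs_div, abs_div, abs_of_pos hs,
    abs_of_pos (hs.trans_le hss')]
  refine hρ.lossPos_mono ?_
  gcongr

theorem meanCensoredLoss_true_parameter {Ω : Type*} (n : ℕ) (β₀ : EuclideanSpace ℝ (Fin p))
    (x : ℕ → Ω → EuclideanSpace ℝ (Fin p)) (u c : ℕ → Ω → ℝ) (ω : Ω)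
    (γ : EuclideanSpace ℝ (Fin p)) (s : ℝ) :
    meanCensoredLoss ρ n (observedResponse β₀ x u c ω) (fun i => x i ω)
      (isUncensored β₀ x u c ω) β₀ γ s =
    meanErrorLoss ρ n (fun i => x i ω) (fun i => u i ω)
      (fun i => c i ω - inner ℝ β₀ (x i ω)) γ s := by
  have h1 : censoredResidual (observedResponse β₀ x u c ω) (fun i => x i ω) β₀ =
      fun i => min (u i ω) (c i ω - inner ℝ β₀ (x i ω)) := by
    funext i
    unfold censoredResidual observedResponse response
    rw [← min_sub_sub_right, add_sub_cancel_left]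
  have h2 : isUncensored β₀ x u c ω = fun i => u i ω ≤ c i ω - inner ℝ β₀ (x i ω) := by
    funext i
    unfold isUncensored response
    exact propext le_sub_iff_add_le'.symm
  unfold meanCensoredLoss meanErrorLoss
  rw [h1, h2]

end ErrorLoss

theorem tendsto_indicator_Ico_neg_natCast (T v : ℝ) :
    Tendsto (fun k : ℕ => (Ico (-(k : ℝ)) T).indicator (fun _ => (1 : ℝ)) v) atTop
      (𝓝 ((Iio T).indicator (fun _ => 1) v)) := by
  refine tendsto_const_nhds.congr' ?_
  filter_upwards [tendsto_natCast_atTop_atTop.eventually (eventually_ge_atTop (-v))] with k hk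
  by_cases hv : v < T
  · rw [indicator_of_mem (show v ∈ Iio T from hv),
      indicator_of_mem (show v ∈ Ico (-(k : ℝ)) T from ⟨by linarith, hv⟩)]
  · rw [indicator_of_notMem (show v ∉ Iio T from hv), indicator_of_notMem fun h => hv h.2]

theorem tendsto_div_natCast_add_one (k : ℝ) :
    Tendsto (fun n : ℕ => k / ((n : ℝ) + 1)) atTop (𝓝 0) :=
  tendsto_const_nhds.div_atTop (tendsto_natCast_atTop_atTop.atTop_add tendsto_const_nhds)

namespace IsCensoredRegressionSample

variable {Ω : Type*} [MeasurableSpace Ω] {P : Measure Ω} {p : ℕ}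
  {x : ℕ → Ω → EuclideanSpace ℝ (Fin p)} {u d : ℕ → Ω → ℝ} {ρ : ℝ → ℝ} {a b : ℝ}
  [IsProbabilityMeasure P]

theorem integral_indicator_Iio_mul_ge (h : IsCensoredRegressionSample P x u d) {q : Ω → ℝ}
    (hq : Measurable q) (hq0 : ∀ ω, 0 ≤ q ω) (hqa : ∀ ω, q ω ≤ a) (T : ℝ) :
    ∫ ω, q ω ∂P - a * survLeft (P.map (u 0)) T ≤
      ∫ ω, (Iio T).indicator (fun _ => (1 : ℝ)) (u 0 ω) * q ω ∂P := by
  have hqi : Integrable q P := Integrable.of_bound hq.aestronglyMeasurable a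
    (ae_of_all _ fun ω => by
      rw [Real.norm_of_nonneg (hq0 ω)]
      exact hqa ω)
  have hA := h.measurable_u 0 (measurableSet_Ici (a := T))
  have hB := h.measurable_u 0 (measurableSet_Iio (a := T))
  have h1 : a * survLeft (P.map (u 0)) T = ∫ ω, (u 0 ⁻¹' Ici T).indicator (fun _ => a) ω ∂P := by
    rw [integral_indicator_const _ hA, smul_eq_mul, mul_comm, survLeft,
      map_measureReal_apply (h.measurable_u 0) measurableSet_Ici]
  have h2 : (fun ω => (Iio T).indicator (fun _ => (1 : ℝ)) (u 0 ω) * q ω) =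
      (u 0 ⁻¹' Iio T).indicator q := by
    funext ω
    by_cases hω : u 0 ω ∈ Iio T
    · rw [indicator_of_mem hω, indicator_of_mem (show ω ∈ u 0 ⁻¹' Iio T from hω), one_mul]
    · rw [indicator_of_notMem hω, indicator_of_notMem (show ω ∉ u 0 ⁻¹' Iio T from hω), zero_mul]
  rw [h1, h2, ← integral_sub hqi ((integrable_const a).indicator hA)]
  refine integral_mono (hqi.sub ((integrable_const a).indicator hA)) (hqi.indicator hB)
    fun ω => ?_
  by_cases hω : u 0 ω < T
  · rw [indicator_of_mem (show ω ∈ u 0 ⁻¹' Iio T from hω),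
      indicator_of_notMem (show ω ∉ u 0 ⁻¹' Ici T from not_le.2 hω), sub_zero]
  · rw [indicator_of_notMem (show ω ∉ u 0 ⁻¹' Iio T from hω),
      indicator_of_mem (show ω ∈ u 0 ⁻¹' Ici T from not_lt.1 hω)]
    linarith [hqa ω]

/-- The mean loss at `0` is eventually below `b` for a scale with limiting loss below `b`. -/
theorem ae_eventually_meanErrorLoss_zero_lt (h : IsCensoredRegressionSample P x u d)
    [NullSingletonClass (P.map (u 0))] (hρ : IsBoundedLoss ρ a) (ha : 0 < a)
    (hD : ∀ T, 0 < survLeft (P.map (u 0)) T → 0 < survLeft (P.map (d 0)) T)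
    {s : ℝ} (hs : 0 < s) (hlt : expectedLoss ρ P x u 0 s < b) :
    ∀ᵐ ω ∂P, ∀ᶠ n : ℕ in atTop,
      meanErrorLoss ρ n (fun i => x i ω) (fun i => u i ω) (fun i => d i ω) 0 s < b := by
  have hPu : IsProbabilityMeasure (P.map (u 0)) :=
    Measure.isProbabilityMeasure_map (h.measurable_u 0).aemeasurable
  set R := lossPos ρ with hR
  have hRm : Measurable R := hρ.lossPos_mono.measurable
  have hm := (h.measurable_residual 0).abs
  obtain ⟨T, hT0, hT⟩ := exists_survLeft_mem_Ioo (P.map (u 0))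
    (show 0 < (b - expectedLoss ρ P x u 0 s) / a from div_pos (sub_pos.2 hlt) ha)
  rw [lt_div_iff₀ ha] at hT
  have h1 := h.integral_indicator_Iio_mul_ge (q := fun ω => a - R (|u 0 ω - inner ℝ 0 (x 0 ω)| / s))
    ((hRm.comp (hm.div_const _)).const_sub a) (fun ω => sub_nonneg.2 (hρ.lossPos_le _))
    (fun ω => sub_le_self _ (hρ.lossPos_nonneg _)) T
  rw [integral_sub (integrable_const a) (integrable_lossPos hρ (hm.div_const _)), integral_const,
    probReal_univ, one_smul] at h1
  have hlim := tendsto_integral_mul_comp (P := P) (Q := fun v => a - R v) (C := a)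
    (hRm.const_sub a) (fun v => by
      rw [abs_of_nonneg (sub_nonneg.2 (hρ.lossPos_le v))]
      exact sub_le_self _ (hρ.lossPos_nonneg v))
    (q := fun k ω => (|u 0 ω - inner ℝ 0 (x 0 ω)| + 2 / ((k : ℝ) + 1)) / s)
    (q' := fun ω => |u 0 ω - inner ℝ 0 (x 0 ω)| / s)
    (fun k => (hm.add_const _).div_const _) (fun ω => by
      simpa using ((tendsto_div_natCast_add_one 2).const_add
        |u 0 ω - inner ℝ 0 (x 0 ω)|).div_const s)
    ((h.ae_continuousAt_lossPos hρ 0 hs.ne').mono fun ω hω => continuousAt_const.sub hω)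
    (χ := fun k ω => (Ico (-(k : ℝ)) T).indicator (fun _ => 1) (u 0 ω))
    (χ' := fun ω => (Iio T).indicator (fun _ => 1) (u 0 ω))
    (fun k => (measurable_const.indicator measurableSet_Ico).comp (h.measurable_u 0))
    (fun k ω => by
      rw [abs_of_nonneg (indicator_nonneg (fun _ _ => zero_le_one) _)]
      exact indicator_apply_le' (fun _ => le_rfl) fun _ => zero_le_one)
    (fun ω => tendsto_indicator_Ico_neg_natCast T _)
  have h2 : a - b < ∫ ω, (Iio T).indicator (fun _ => (1 : ℝ)) (u 0 ω) *
      (a - R (|u 0 ω - inner ℝ 0 (x 0 ω)| / s)) ∂P := by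
    have h3 : ∫ ω, R (|u 0 ω - inner ℝ 0 (x 0 ω)| / s) ∂P = expectedLoss ρ P x u 0 s := rfl
    rw [h3] at h1
    linarith
  obtain ⟨k, hk1, hk2⟩ := ((hlim.eventually (lt_mem_nhds h2)).and
    (tendsto_natCast_atTop_atTop.eventually (eventually_ge_atTop (-T)))).exists
  have hη : 0 < 1 / ((k : ℝ) + 1) := by positivity
  have henv : ∀ (v v' : ℝ) (m : ℝ), |v - v'| ≤ 1 / ((k : ℝ) + 1) →
      a - R ((|v| + (m + 1 / ((k : ℝ) + 1))) / s) ≤ a - R ((|v'| + m) / s) := by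
    intro v v' m hv
    refine sub_le_sub_left (hρ.lossPos_mono ?_) a
    have := abs_sub_abs_le_abs_sub v' v
    rw [abs_sub_comm] at this
    apply div_le_div_of_nonneg_right _ hs.le
    linarith
  filter_upwards [h.ae_eventually_le_average (mul_pos hT0 (hD T hT0))
    (g := fun v _ => a - R (|v| / s)) (g' := fun v _ => a - R ((|v| + 1 / ((k : ℝ) + 1)) / s))
    (g'' := fun v _ => a - R ((|v| + 2 / ((k : ℝ) + 1)) / s)) (C := a) hη
    (fun v => measurable_const) ((hRm.comp (by fun_prop)).const_sub a)
    (fun v w => sub_nonneg.2 (hρ.lossPos_le _)) (fun v w => sub_nonneg.2 (hρ.lossPos_le _))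
    (fun v w => sub_nonneg.2 (hρ.lossPos_le _)) (fun v w => sub_le_self _ (hρ.lossPos_nonneg _))
    (fun v v' w hv => by simpa using henv v v' 0 hv)
    (fun v v' w hv => by
      have := henv v v' (1 / ((k : ℝ) + 1)) hv
      rwa [← add_div, one_add_one_eq_two] at this)
    (s := -(k : ℝ)) (by linarith) (half_pos (sub_pos.2 hk1))] with ω hω
  filter_upwards [hω, eventually_gt_atTop 0] with n hn hn0
  have h3 : ∫ ω, (Ico (-(k : ℝ)) T).indicator (fun v => a - R ((|v| + 2 / ((k : ℝ) + 1)) / s))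
      (u 0 ω) ∂P = ∫ ω, (Ico (-(k : ℝ)) T).indicator (fun _ => 1) (u 0 ω) *
      (a - R ((|u 0 ω - inner ℝ 0 (x 0 ω)| + 2 / ((k : ℝ) + 1)) / s)) ∂P := by
    congr 1
    funext ω
    rw [inner_zero_left, sub_zero]
    by_cases hv : u 0 ω ∈ Ico (-(k : ℝ)) T
    · rw [indicator_of_mem hv, indicator_of_mem hv, one_mul]
    · rw [indicator_of_notMem hv, indicator_of_notMem hv, zero_mul]
  rw [h3] at hn
  have h4 : meanErrorLoss ρ n (fun i => x i ω) (fun i => u i ω) (fun i => d i ω) 0 s +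
      (1 / (n : ℝ)) * ∑ i ∈ Finset.range n, kmCondExp n (fun i => min (u i ω) (d i ω))
        (fun i => u i ω ≤ d i ω) (fun v => a - R (|v| / s)) i ≤ a := by
    unfold meanErrorLoss
    rw [← mul_add, ← Finset.sum_add_distrib]
    have h5 : ∀ i ∈ Finset.range n, kmCondExp n (fun i => min (u i ω) (d i ω))
        (fun i => u i ω ≤ d i ω) (fun v => ρ ((v - inner ℝ 0 (x i ω)) / s)) i +
        kmCondExp n (fun i => min (u i ω) (d i ω)) (fun i => u i ω ≤ d i ω)
          (fun v => a - R (|v| / s)) i ≤ a := by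
      intro i _
      rw [← kmCondExp_add]
      have h6 : (fun v => ρ ((v - inner ℝ 0 (x i ω)) / s) + (a - R (|v| / s))) = fun _ => a := by
        funext v
        rw [inner_zero_left, sub_zero, ← hρ.lossPos_abs, abs_div, abs_of_pos hs]
        ring
      rw [h6]
      exact kmCondExp_const_le ha.le i
    refine (mul_le_mul_of_nonneg_left (Finset.sum_le_sum h5) (by positivity)).trans (le_of_eq ?_)
    have hn' : (n : ℝ) ≠ 0 := by positivity
    rw [Finset.sum_const, Finset.card_range, nsmul_eq_mul, ← mul_assoc, one_div_mul_cancel hn',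
      one_mul]
  linarith

/-- Near a point whose limiting loss at scale `s` exceeds `b`, the mean loss is eventually at
least `b`, uniformly and at a slightly larger scale. -/
theorem exists_ball_le_meanErrorLoss (h : IsCensoredRegressionSample P x u d)
    [NullSingletonClass (P.map (u 0))] (hρ : IsBoundedLoss ρ a) (ha : 0 < a)
    (hD : ∀ T, 0 < survLeft (P.map (u 0)) T → 0 < survLeft (P.map (d 0)) T)
    {s : ℝ} (hs : 0 < s) {γ₀ : EuclideanSpace ℝ (Fin p)} (hlt : b < expectedLoss ρ P x u γ₀ s) :
    ∃ r > 0, ∃ σ > s, ∀ᵐ ω ∂P, ∀ᶠ n : ℕ in atTop, ∀ γ ∈ Metric.ball γ₀ r,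
      b ≤ meanErrorLoss ρ n (fun i => x i ω) (fun i => u i ω) (fun i => d i ω) γ σ := by
  have hPu : IsProbabilityMeasure (P.map (u 0)) :=
    Measure.isProbabilityMeasure_map (h.measurable_u 0).aemeasurable
  set R := lossPos ρ with hR
  have hRm : Measurable R := hρ.lossPos_mono.measurable
  have hRb : ∀ v, |R v| ≤ a := fun v => by
    rw [abs_of_nonneg (hρ.lossPos_nonneg v)]
    exact hρ.lossPos_le v
  have hm := (h.measurable_residual γ₀).abs
  obtain ⟨T, hT0, hT⟩ := exists_survLeft_mem_Ioo (P.map (u 0))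
    (show 0 < (expectedLoss ρ P x u γ₀ s - b) / a from div_pos (sub_pos.2 hlt) ha)
  rw [lt_div_iff₀ ha] at hT
  have h1 := h.integral_indicator_Iio_mul_ge (q := fun ω => R (|u 0 ω - inner ℝ γ₀ (x 0 ω)| / s))
    (hRm.comp (hm.div_const _)) (fun ω => hρ.lossPos_nonneg _) (fun ω => hρ.lossPos_le _) T
  have hball : ∀ k : ℕ, MeasurableSet {w : EuclideanSpace ℝ (Fin p) | ‖w‖ ≤ k} := fun k =>
    measurableSet_le measurable_norm measurable_const
  have hlim := tendsto_integral_mul_comp (P := P) hRm hRb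
    (q := fun k ω => (|u 0 ω - inner ℝ γ₀ (x 0 ω)| - 3 / ((k : ℝ) + 1)) / (s + 1 / ((k : ℝ) + 1)))
    (q' := fun ω => |u 0 ω - inner ℝ γ₀ (x 0 ω)| / s)
    (fun k => (hm.sub_const _).div_const _) (fun ω => by
      have := ((tendsto_div_natCast_add_one 3).const_sub |u 0 ω - inner ℝ γ₀ (x 0 ω)|).div
        ((tendsto_div_natCast_add_one 1).const_add s) (by simpa using hs.ne')
      rw [sub_zero, add_zero] at this
      exact this)
    (h.ae_continuousAt_lossPos hρ γ₀ hs.ne')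
    (χ := fun k ω => (Ico (-(k : ℝ)) T).indicator (fun _ => 1) (u 0 ω) *
      {w | ‖w‖ ≤ k}.indicator (fun _ => 1) (x 0 ω))
    (χ' := fun ω => (Iio T).indicator (fun _ => 1) (u 0 ω))
    (fun k => ((measurable_const.indicator measurableSet_Ico).comp (h.measurable_u 0)).mul
      ((measurable_const.indicator (hball k)).comp (h.measurable_x 0)))
    (fun k ω => by
      have h1 : 0 ≤ (Ico (-(k : ℝ)) T).indicator (fun _ => (1 : ℝ)) (u 0 ω) :=
        indicator_nonneg (fun _ _ => zero_le_one) _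
      have h2 : 0 ≤ {w | ‖w‖ ≤ k}.indicator (fun _ => (1 : ℝ)) (x 0 ω) :=
        indicator_nonneg (fun _ _ => zero_le_one) _
      rw [abs_of_nonneg (mul_nonneg h1 h2)]
      exact mul_le_one₀ (indicator_apply_le' (fun _ => le_rfl) fun _ => zero_le_one) h2
        (indicator_apply_le' (fun _ => le_rfl) fun _ => zero_le_one))
    (fun ω => by
      have h2 : Tendsto (fun k : ℕ => {w : EuclideanSpace ℝ (Fin p) | ‖w‖ ≤ k}.indicator
          (fun _ => (1 : ℝ)) (x 0 ω)) atTop (𝓝 1) := by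
        refine tendsto_const_nhds.congr' ?_
        filter_upwards [tendsto_natCast_atTop_atTop.eventually
          (eventually_ge_atTop ‖x 0 ω‖)] with k hk
        rw [indicator_of_mem (show x 0 ω ∈ {w | ‖w‖ ≤ k} from hk)]
      simpa using (tendsto_indicator_Ico_neg_natCast T (u 0 ω)).mul h2)
  have h2 : b < ∫ ω, (Iio T).indicator (fun _ => (1 : ℝ)) (u 0 ω) *
      R (|u 0 ω - inner ℝ γ₀ (x 0 ω)| / s) ∂P := by
    have h3 : ∫ ω, R (|u 0 ω - inner ℝ γ₀ (x 0 ω)| / s) ∂P = expectedLoss ρ P x u γ₀ s := rfl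
    rw [h3] at h1
    linarith
  obtain ⟨k, hk1, hk2⟩ := ((hlim.eventually (lt_mem_nhds h2)).and
    (tendsto_natCast_atTop_atTop.eventually (eventually_ge_atTop (-T)))).exists
  set η := 1 / ((k : ℝ) + 1) with hηdef
  have hη : 0 < η := by positivity
  have hη3 : 3 / ((k : ℝ) + 1) = 3 * η := by
    rw [hηdef]
    ring
  rw [hη3] at hk1
  set σ := s + η with hσ
  have hσ0 : 0 < σ := by positivity
  set B : Set (EuclideanSpace ℝ (Fin p)) := {w | ‖w‖ ≤ k} with hB
  have hRi : ∀ v : ℝ, Measurable fun w => B.indicator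
      (fun w => R ((|v - inner ℝ γ₀ w| - 2 * η) / σ)) w := fun v =>
    (hRm.comp (by fun_prop)).indicator (hball k)
  have hRi2 : Measurable fun z : ℝ × EuclideanSpace ℝ (Fin p) => B.indicator
      (fun w => R ((|z.1 - inner ℝ γ₀ w| - 3 * η) / σ)) z.2 := by
    have : (fun z : ℝ × EuclideanSpace ℝ (Fin p) => B.indicator
      (fun w => R ((|z.1 - inner ℝ γ₀ w| - 3 * η) / σ)) z.2) = (Prod.snd ⁻¹' B).indicator
      fun z => R ((|z.1 - inner ℝ γ₀ z.2| - 3 * η) / σ) := rfl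
    rw [this]
    exact (hRm.comp (by fun_prop)).indicator (measurable_snd (hball k))
  have hnn : ∀ v w m, 0 ≤ B.indicator (fun w => R ((|v - inner ℝ γ₀ w| - m) / σ)) w :=
    fun v w m => indicator_nonneg (fun _ _ => hρ.lossPos_nonneg _) _
  have henv : ∀ (v v' : ℝ) (w : EuclideanSpace ℝ (Fin p)) (m : ℝ), |v - v'| ≤ η →
      B.indicator (fun w => R ((|v - inner ℝ γ₀ w| - (m + η)) / σ)) w ≤
      B.indicator (fun w => R ((|v' - inner ℝ γ₀ w| - m) / σ)) w := by
    intro v v' w m hv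
    refine indicator_le_indicator (hρ.lossPos_mono ?_)
    apply div_le_div_of_nonneg_right _ hσ0.le
    have := abs_sub_abs_le_abs_sub (v - inner ℝ γ₀ w) (v' - inner ℝ γ₀ w)
    rw [sub_sub_sub_cancel_right] at this
    linarith
  refine ⟨η / ((k : ℝ) + 1), by positivity, σ, by linarith, ?_⟩
  filter_upwards [h.ae_eventually_le_average (mul_pos hT0 (hD T hT0))
    (g := fun v w => B.indicator (fun w => R ((|v - inner ℝ γ₀ w| - η) / σ)) w)
    (g' := fun v w => B.indicator (fun w => R ((|v - inner ℝ γ₀ w| - 2 * η) / σ)) w)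
    (g'' := fun v w => B.indicator (fun w => R ((|v - inner ℝ γ₀ w| - 3 * η) / σ)) w)
    (C := a) hη hRi hRi2 (fun v w => hnn v w _) (fun v w => hnn v w _) (fun v w => hnn v w _)
    (fun v w => indicator_apply_le' (fun _ => hρ.lossPos_le _) fun _ => ha.le)
    (fun v v' w hv => by
      have := henv v v' w η hv
      rwa [← two_mul] at this)
    (fun v v' w hv => by
      have := henv v v' w (2 * η) hv
      rwa [show 2 * η + η = 3 * η by ring] at this)
    (s := -(k : ℝ)) (by linarith) (half_pos (sub_pos.2 hk1))] with ω hω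
  filter_upwards [hω] with n hn γ hγ
  have h3 : ∫ ω, (Ico (-(k : ℝ)) T).indicator (fun v => B.indicator
      (fun w => R ((|v - inner ℝ γ₀ w| - 3 * η) / σ)) (x 0 ω)) (u 0 ω) ∂P =
      ∫ ω, (Ico (-(k : ℝ)) T).indicator (fun _ => 1) (u 0 ω) *
      B.indicator (fun _ => 1) (x 0 ω) *
      R ((|u 0 ω - inner ℝ γ₀ (x 0 ω)| - 3 * η) / σ) ∂P := by
    congr 1
    funext ω
    by_cases hv : u 0 ω ∈ Ico (-(k : ℝ)) T
    · rw [indicator_of_mem hv, indicator_of_mem hv, one_mul]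
      by_cases hw : x 0 ω ∈ B
      · rw [indicator_of_mem hw, indicator_of_mem hw, one_mul]
      · rw [indicator_of_notMem hw, indicator_of_notMem hw, zero_mul]
    · rw [indicator_of_notMem hv, indicator_of_notMem hv, zero_mul, zero_mul]
  rw [h3] at hn
  refine le_trans (by linarith) (hn.trans ?_)
  refine mul_le_mul_of_nonneg_left (Finset.sum_le_sum fun i hi => ?_) (by positivity)
  refine kmCondExp_mono (fun j _ => ?_) (Finset.mem_range.1 hi)
  refine indicator_apply_le' (fun hw => ?_) fun _ => hρ.nonneg _
  rw [← hρ.lossPos_abs, abs_div, abs_of_pos hσ0]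
  refine hρ.lossPos_mono (div_le_div_of_nonneg_right ?_ hσ0.le)
  have h4 : |inner ℝ γ (x i ω) - inner ℝ γ₀ (x i ω)| ≤ η := by
    rw [← inner_sub_left]
    refine (abs_real_inner_le_norm _ _).trans ?_
    have h5 : ‖γ - γ₀‖ ≤ η / ((k : ℝ) + 1) := by
      rw [← dist_eq_norm]
      exact (Metric.mem_ball.1 hγ).le
    have h6 : ‖x i ω‖ ≤ (k : ℝ) + 1 := by
      have : ‖x i ω‖ ≤ (k : ℝ) := hw
      linarith
    calc ‖γ - γ₀‖ * ‖x i ω‖ ≤ η / ((k : ℝ) + 1) * ((k : ℝ) + 1) := by gcongr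
      _ = η := div_mul_cancel₀ _ (by positivity)
  have h5 := abs_sub_abs_le_abs_sub (min (u j ω) (d j ω) - inner ℝ γ₀ (x i ω))
    (min (u j ω) (d j ω) - inner ℝ γ (x i ω))
  rw [sub_sub_sub_cancel_left] at h5
  linarith

end IsCensoredRegressionSample

namespace IsCensoredRegressionSample

variable {Ω : Type*} [MeasurableSpace Ω] {P : Measure Ω} {p : ℕ}
  {x : ℕ → Ω → EuclideanSpace ℝ (Fin p)} {u d : ℕ → Ω → ℝ} {ρ : ℝ → ℝ} {a b : ℝ}
  [IsProbabilityMeasure P]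

/-- Far away in directions close to `θ₀` the mean loss is eventually at least `b`. -/
theorem exists_ball_forall_ge_le_meanErrorLoss (h : IsCensoredRegressionSample P x u d)
    [NullSingletonClass (P.map (u 0))] (hρ : IsBoundedLoss ρ a) (ha : 0 < a) (hb : 0 < b)
    (hD : ∀ T, 0 < survLeft (P.map (u 0)) T → 0 < survLeft (P.map (d 0)) T)
    {σ : ℝ} (hσ : 0 < σ) {θ₀ : EuclideanSpace ℝ (Fin p)}
    (hG : b / a < (P.map (x 0)).real {v | inner ℝ θ₀ v ≠ 0}) :
    ∃ r > 0, ∃ L : ℝ, ∀ᵐ ω ∂P, ∀ᶠ n : ℕ in atTop, ∀ θ ∈ Metric.ball θ₀ r, ∀ l ≥ L,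
      b ≤ meanErrorLoss ρ n (fun i => x i ω) (fun i => u i ω) (fun i => d i ω) (l • θ) σ := by
  have hPu : IsProbabilityMeasure (P.map (u 0)) :=
    Measure.isProbabilityMeasure_map (h.measurable_u 0).aemeasurable
  have hPx : IsProbabilityMeasure (P.map (x 0)) :=
    Measure.isProbabilityMeasure_map (h.measurable_x 0).aemeasurable
  set F := survLeft (P.map (u 0)) with hF
  set B : ℕ → Set (EuclideanSpace ℝ (Fin p)) := fun k =>
    {w | ‖w‖ ≤ k ∧ 1 / ((k : ℝ) + 1) ≤ |inner ℝ θ₀ w|} with hB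
  have hBm : ∀ k, MeasurableSet (B k) := fun k => by
    have hi : Measurable fun w : EuclideanSpace ℝ (Fin p) => |inner ℝ θ₀ w| := by fun_prop
    exact (measurableSet_le measurable_norm measurable_const).inter
      (measurableSet_le measurable_const hi)
  have hBmono : Monotone B := by
    intro k l hkl w hw
    have hkl' : (k : ℝ) ≤ l := by exact_mod_cast hkl
    refine ⟨hw.1.trans hkl', le_trans ?_ hw.2⟩
    gcongr
  have hBU : ⋃ k, B k = {w | inner ℝ θ₀ w ≠ 0} := by
    ext w
    simp only [mem_iUnion]
    constructor
    · rintro ⟨k, hk⟩ h0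
      have h1 : (0 : ℝ) < 1 / ((k : ℝ) + 1) := by positivity
      have h2 := hk.2
      rw [show inner ℝ θ₀ w = 0 from h0, abs_zero] at h2
      linarith
    · intro hw
      obtain ⟨k, hk1, hk2⟩ := ((tendsto_natCast_atTop_atTop.eventually
        (eventually_ge_atTop ‖w‖)).and ((tendsto_div_natCast_add_one 1).eventually
        (ge_mem_nhds (abs_pos.2 hw)))).exists
      exact ⟨k, hk1, hk2⟩
  have hBlim : Tendsto (fun k => (P.map (x 0)).real (B k)) atTop
      (𝓝 ((P.map (x 0)).real {w | inner ℝ θ₀ w ≠ 0})) := by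
    rw [← hBU]
    exact (ENNReal.tendsto_toReal (measure_ne_top _ _)).comp (tendsto_measure_iUnion_atTop hBmono)
  set π := (P.map (x 0)).real {w | inner ℝ θ₀ w ≠ 0} with hπ
  rw [div_lt_iff₀ ha] at hG
  have hπ1 : π ≤ 1 := measureReal_le_one
  obtain ⟨T, hT0, hT⟩ := exists_survLeft_mem_Ioo (P.map (u 0))
    (show 0 < (π * a - b) / a from div_pos (sub_pos.2 hG) ha)
  rw [lt_div_iff₀ ha] at hT
  have hlim : Tendsto (fun k : ℕ => (F (-(k : ℝ)) - F T) *
      ((a - 1 / ((k : ℝ) + 1)) * (P.map (x 0)).real (B k))) atTop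
      (𝓝 ((1 - F T) * ((a - 0) * π))) := by
    refine (Tendsto.sub_const ?_ _).mul (((tendsto_div_natCast_add_one 1).const_sub a).mul hBlim)
    exact (tendsto_survLeft_atBot _).comp
      (tendsto_neg_atTop_atBot.comp tendsto_natCast_atTop_atTop)
  have hlt : b < (1 - F T) * ((a - 0) * π) := by
    have : F T * a * π ≤ F T * a := mul_le_of_le_one_right (by positivity) hπ1
    nlinarith
  obtain ⟨k, hk1, hk2⟩ := ((hlim.eventually (lt_mem_nhds hlt)).and
    (tendsto_natCast_atTop_atTop.eventually (eventually_ge_atTop |T|))).exists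
  have hkT : -(k : ℝ) ≤ T := by linarith [neg_abs_le T]
  set κ := a - 1 / ((k : ℝ) + 1) with hκ
  have hκ0 : 0 < κ := by
    have h1 : 0 ≤ F (-(k : ℝ)) - F T := sub_nonneg.2 (survLeft_antitone _ hkT)
    have h2 : 0 ≤ (P.map (x 0)).real (B k) := measureReal_nonneg
    by_contra! h3
    have : (F (-(k : ℝ)) - F T) * (κ * (P.map (x 0)).real (B k)) ≤ 0 :=
      mul_nonpos_of_nonneg_of_nonpos h1 (mul_nonpos_of_nonpos_of_nonneg h3 h2)
    linarith
  obtain ⟨M, hM0, hM⟩ := hρ.exists_lt_lossPos (show κ < a by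
    rw [hκ]
    have : 0 < 1 / ((k : ℝ) + 1) := by positivity
    linarith)
  have hint : ∫ ω, (B k).indicator (fun _ => κ) (x 0 ω) ∂P = κ * (P.map (x 0)).real (B k) := by
    have : (fun ω => (B k).indicator (fun _ => κ) (x 0 ω)) =
      (x 0 ⁻¹' B k).indicator fun _ => κ := rfl
    rw [this, integral_indicator_const _ (h.measurable_x 0 (hBm k)), smul_eq_mul, mul_comm,
      map_measureReal_apply (h.measurable_x 0) (hBm k)]
  have hk0 : (0 : ℝ) < (k : ℝ) + 1 := by positivity
  refine ⟨1 / (2 * ((k : ℝ) + 1) ^ 2), by positivity, 2 * ((k : ℝ) + 1) * (M * σ + k), ?_⟩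
  filter_upwards [h.ae_eventually_le_average_Ico hkT (mul_pos hT0 (hD T hT0))
    (φ := (B k).indicator fun _ => κ) (measurable_const.indicator (hBm k))
    (fun w => indicator_nonneg (fun _ _ => hκ0.le) _) (C := κ)
    (fun w => indicator_apply_le' (fun _ => le_rfl) fun _ => hκ0.le) (sub_pos.2 hk1)] with ω hω
  filter_upwards [hω] with n hn θ hθ l hl
  rw [hint, measureReal_Ico_eq _ hkT, ← hF] at hn
  refine le_trans (by linarith) (hn.trans ?_)
  refine mul_le_mul_of_nonneg_left (Finset.sum_le_sum fun i hi => ?_) (by positivity)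
  refine kmCondExp_mono (fun j _ => ?_) (Finset.mem_range.1 hi)
  by_cases hw : x i ω ∈ B k
  swap
  · rw [indicator_of_notMem hw, zero_mul]
    exact hρ.nonneg _
  by_cases hv : min (u j ω) (d j ω) ∈ Ico (-(k : ℝ)) T
  swap
  · rw [indicator_of_notMem hv, mul_zero]
    exact hρ.nonneg _
  rw [indicator_of_mem hw, indicator_of_mem hv, Pi.one_apply, mul_one, ← hρ.lossPos_abs, abs_div,
    abs_of_pos hσ]
  refine (hM _ ?_).le
  rw [le_div_iff₀ hσ]
  have h1 : |inner ℝ θ (x i ω) - inner ℝ θ₀ (x i ω)| ≤ 1 / (2 * ((k : ℝ) + 1)) := by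
    rw [← inner_sub_left]
    refine (abs_real_inner_le_norm _ _).trans ?_
    have h5 : ‖θ - θ₀‖ ≤ 1 / (2 * ((k : ℝ) + 1) ^ 2) := by
      rw [← dist_eq_norm]
      exact (Metric.mem_ball.1 hθ).le
    have h6 : ‖x i ω‖ ≤ (k : ℝ) + 1 := by linarith [hw.1]
    calc ‖θ - θ₀‖ * ‖x i ω‖ ≤ 1 / (2 * ((k : ℝ) + 1) ^ 2) * ((k : ℝ) + 1) := by gcongr
      _ = 1 / (2 * ((k : ℝ) + 1)) := by field_simp
  have h2 : 1 / (2 * ((k : ℝ) + 1)) ≤ |inner ℝ θ (x i ω)| := by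
    have h3 := abs_sub_abs_le_abs_sub (inner ℝ θ₀ (x i ω)) (inner ℝ θ (x i ω))
    rw [abs_sub_comm] at h3
    have h4 : 1 / ((k : ℝ) + 1) = 1 / (2 * ((k : ℝ) + 1)) + 1 / (2 * ((k : ℝ) + 1)) := by
      field_simp
      norm_num
    linarith [hw.2]
  have hvk : |min (u j ω) (d j ω)| ≤ k := by
    rw [abs_le]
    exact ⟨hv.1, hv.2.le.trans ((le_abs_self T).trans hk2)⟩
  have hl0 : 0 ≤ l := le_trans (by positivity) hl
  have h3 : M * σ + k ≤ |l * inner ℝ θ (x i ω)| := by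
    rw [abs_mul, abs_of_nonneg hl0]
    calc M * σ + k = 2 * ((k : ℝ) + 1) * (M * σ + k) * (1 / (2 * ((k : ℝ) + 1))) := by
          field_simp
      _ ≤ l * |inner ℝ θ (x i ω)| := mul_le_mul hl h2 (by positivity) hl0
  rw [real_inner_smul_left]
  have h4 := abs_sub_abs_le_abs_sub (l * inner ℝ θ (x i ω)) (min (u j ω) (d j ω))
  rw [abs_sub_comm] at h4
  linarith

/-- Away from `0` the mean loss is eventually at least `b`, uniformly and at a scale slightly
larger than `s`, if the limiting loss at scale `s` exceeds `b` there. -/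
theorem exists_scale_le_meanErrorLoss (h : IsCensoredRegressionSample P x u d)
    [NullSingletonClass (P.map (u 0))] (hρ : IsBoundedLoss ρ a) (ha : 0 < a) (hb : 0 < b)
    (hD : ∀ T, 0 < survLeft (P.map (u 0)) T → 0 < survLeft (P.map (d 0)) T)
    (hG : ∀ β : EuclideanSpace ℝ (Fin p), β ≠ 0 →
      b / a < (P.map (x 0)).real {v | inner ℝ β v ≠ 0})
    {s : ℝ} (hs : 0 < s) (hlt : ∀ γ ≠ 0, b < expectedLoss ρ P x u γ s) {ε : ℝ} (hε : 0 < ε) :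
    ∃ σ > s, ∀ᵐ ω ∂P, ∀ᶠ n : ℕ in atTop, ∀ γ, ε ≤ ‖γ‖ →
      b ≤ meanErrorLoss ρ n (fun i => x i ω) (fun i => u i ω) (fun i => d i ω) γ σ := by
  obtain ⟨L, hL⟩ : ∃ L : ℝ, ∀ᵐ ω ∂P, ∀ᶠ n : ℕ in atTop,
      ∀ θ ∈ Metric.sphere (0 : EuclideanSpace ℝ (Fin p)) 1, ∀ l ≥ L,
      b ≤ meanErrorLoss ρ n (fun i => x i ω) (fun i => u i ω) (fun i => d i ω) (l • θ)
        (s + 1) := by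
    refine (isCompact_sphere (0 : EuclideanSpace ℝ (Fin p)) 1).induction_on
      (p := fun S => ∃ L : ℝ, ∀ᵐ ω ∂P, ∀ᶠ n : ℕ in atTop, ∀ θ ∈ S, ∀ l ≥ L,
        b ≤ meanErrorLoss ρ n (fun i => x i ω) (fun i => u i ω) (fun i => d i ω) (l • θ)
          (s + 1)) ?_ ?_ ?_ ?_
    · exact ⟨0, ae_of_all _ fun ω => Eventually.of_forall fun n θ hθ => absurd hθ (by simp)⟩
    · rintro S S' hSS' ⟨L, hL⟩
      exact ⟨L, hL.mono fun ω hω => hω.mono fun n hn θ hθ => hn θ (hSS' hθ)⟩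
    · rintro S S' ⟨L, hL⟩ ⟨L', hL'⟩
      refine ⟨max L L', ?_⟩
      filter_upwards [hL, hL'] with ω h1 h2
      filter_upwards [h1, h2] with n h1 h2 θ hθ l hl
      rcases hθ with hθ | hθ
      · exact h1 θ hθ l ((le_max_left _ _).trans hl)
      · exact h2 θ hθ l ((le_max_right _ _).trans hl)
    · intro θ₀ hθ₀
      have hne : θ₀ ≠ 0 := Metric.ne_of_mem_sphere hθ₀ one_ne_zero
      obtain ⟨r, hr, L, hL⟩ := h.exists_ball_forall_ge_le_meanErrorLoss hρ ha hb hD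
        (show 0 < s + 1 by positivity) (hG θ₀ hne)
      exact ⟨Metric.ball θ₀ r, mem_nhdsWithin_of_mem_nhds (Metric.ball_mem_nhds θ₀ hr), L, hL⟩
  obtain ⟨σ, hσ, hann⟩ : ∃ σ > s, ∀ᵐ ω ∂P, ∀ᶠ n : ℕ in atTop,
      ∀ γ ∈ Metric.closedBall (0 : EuclideanSpace ℝ (Fin p)) L \ Metric.ball 0 ε,
      b ≤ meanErrorLoss ρ n (fun i => x i ω) (fun i => u i ω) (fun i => d i ω) γ σ := by
    refine ((isCompact_closedBall (0 : EuclideanSpace ℝ (Fin p)) L).diff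
      Metric.isOpen_ball).induction_on
      (p := fun S => ∃ σ > s, ∀ᵐ ω ∂P, ∀ᶠ n : ℕ in atTop, ∀ γ ∈ S,
        b ≤ meanErrorLoss ρ n (fun i => x i ω) (fun i => u i ω) (fun i => d i ω) γ σ) ?_ ?_ ?_ ?_
    · exact ⟨s + 1, by linarith, ae_of_all _ fun ω => Eventually.of_forall fun n θ hθ =>
        absurd hθ (by simp)⟩
    · rintro S S' hSS' ⟨σ, hσ, hS⟩
      exact ⟨σ, hσ, hS.mono fun ω hω => hω.mono fun n hn θ hθ => hn θ (hSS' hθ)⟩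
    · rintro S S' ⟨σ, hσ, hS⟩ ⟨σ', hσ', hS'⟩
      have hmin : s < min σ σ' := lt_min hσ hσ'
      refine ⟨min σ σ', hmin, ?_⟩
      filter_upwards [hS, hS'] with ω h1 h2
      filter_upwards [h1, h2] with n h1 h2 γ hγ
      rcases hγ with hγ | hγ
      · exact (h1 γ hγ).trans (meanErrorLoss_anti hρ γ (hs.trans hmin) (min_le_left _ _))
      · exact (h2 γ hγ).trans (meanErrorLoss_anti hρ γ (hs.trans hmin) (min_le_right _ _))
    · intro γ₀ hγ₀
      have hne : γ₀ ≠ 0 := by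
        rintro rfl
        exact hγ₀.2 (Metric.mem_ball_self hε)
      obtain ⟨r, hr, σ, hσ, hL⟩ := h.exists_ball_le_meanErrorLoss hρ ha hD hs (hlt γ₀ hne)
      exact ⟨Metric.ball γ₀ r, mem_nhdsWithin_of_mem_nhds (Metric.ball_mem_nhds γ₀ hr), σ, hσ, hL⟩
  have hmin : s < min σ (s + 1) := lt_min hσ (by linarith)
  refine ⟨min σ (s + 1), hmin, ?_⟩
  filter_upwards [hL, hann] with ω h1 h2
  filter_upwards [h1, h2] with n h1 h2 γ hγ
  rcases le_total ‖γ‖ L with hle | hle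
  · refine (h2 γ ⟨by simpa using hle, by simpa using hγ⟩).trans
      (meanErrorLoss_anti hρ γ (hs.trans hmin) (min_le_left _ _))
  · have hne : ‖γ‖ ≠ 0 := (hε.trans_le hγ).ne'
    have h3 := h1 (‖γ‖⁻¹ • γ) (by simp [norm_smul, hne]) ‖γ‖ hle
    rw [smul_smul, mul_inv_cancel₀ hne, one_smul] at h3
    exact h3.trans (meanErrorLoss_anti hρ γ (hs.trans hmin) (min_le_right _ _))

end IsCensoredRegressionSample

/-- Strong consistency of the censored S-regression of the residuals at the true parameter.
The law of `u 0` is `F₀`, the law of `x 0` is `G`, and the law of `c 0 - β₀' x 0` is the law `D` of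
the censoring variable of the error. -/
theorem theorem5 {Ω : Type*} [MeasurableSpace Ω] (P : Measure Ω) [IsProbabilityMeasure P]
    {p : ℕ} (β₀ : EuclideanSpace ℝ (Fin p))
    (x : ℕ → Ω → EuclideanSpace ℝ (Fin p)) (u c : ℕ → Ω → ℝ)
    (hmodel : IsCensoredRegressionSample P x u c)
    (ρ : ℝ → ℝ) (a b : ℝ) (hρ : IsBoundedLoss ρ a) (ha : 0 < a) (hb : 0 < b)
    (hF : HasSymmetricUnimodalDensity (P.map (u 0)))
    (hG : ∀ β : EuclideanSpace ℝ (Fin p), β ≠ 0 →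
      b / a < (P.map (x 0)).real {v | inner ℝ β v ≠ 0})
    (hR1 : EndpointCondition (P.map (u 0)) (P.map (fun ω => c 0 ω - inner ℝ β₀ (x 0 ω))))
    (hR2 : NoCommonJumps (P.map (u 0)) (P.map (fun ω => c 0 ω - inner ℝ β₀ (x 0 ω)))) :
    ∀ᵐ ω ∂P,
      (∀ᶠ n in atTop, (sampleArgmin ρ b β₀ x u c n ω β₀).Nonempty) ∧
      ∀ γ : ℕ → EuclideanSpace ℝ (Fin p),
        (∀ᶠ n in atTop, γ n ∈ sampleArgmin ρ b β₀ x u c n ω β₀) →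
          Tendsto γ atTop (𝓝 0) := by
  rcases subsingleton_or_nontrivial (EuclideanSpace ℝ (Fin p)) with hp | hp
  · refine ae_of_all _ fun ω => ⟨Eventually.of_forall fun n => ⟨0, fun γ' => ?_⟩, fun γ _ => ?_⟩
    · rw [Subsingleton.elim γ' 0]
    · rw [show γ = fun _ => 0 from Subsingleton.elim _ _]
      exact tendsto_const_nhds
  have h := hmodel.censoring_of_error β₀
  have hPu : IsProbabilityMeasure (P.map (u 0)) :=
    Measure.isProbabilityMeasure_map (h.measurable_u 0).aemeasurable
  have hPd : IsProbabilityMeasure (P.map fun ω => c 0 ω - inner ℝ β₀ (x 0 ω)) :=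
    Measure.isProbabilityMeasure_map (h.measurable_c 0).aemeasurable
  have hPx : IsProbabilityMeasure (P.map (x 0)) :=
    Measure.isProbabilityMeasure_map (h.measurable_x 0).aemeasurable
  have hna := hF.nullSingletonClass
  have hD : ∀ T, 0 < survLeft (P.map (u 0)) T →
      0 < survLeft (P.map fun ω => c 0 ω - inner ℝ β₀ (x 0 ω)) T := fun T hT => hR1.survLeft_pos hT
  have hba : b < a := by
    obtain ⟨β, hβ⟩ := exists_ne (0 : EuclideanSpace ℝ (Fin p))
    have := (hG β hβ).trans_le measureReal_le_one
    rwa [div_lt_one ha] at this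
  obtain ⟨s₀, hs₀, hbs₀, hlt₀⟩ := h.exists_errorScale hρ hb hba
  have hgt : ∀ γ ≠ 0, b < expectedLoss ρ P x u γ s₀ := fun γ hγ =>
    hbs₀.trans_lt (h.expectedLoss_zero_lt hF hρ hs₀ (hb.trans_le hbs₀)
      ((div_pos hb ha).trans (hG γ hγ)))
  have key : ∀ ε > 0, ∀ᵐ ω ∂P, ∀ᶠ n in atTop, ∀ γ : EuclideanSpace ℝ (Fin p), ε ≤ ‖γ‖ →
      censoredMScale ρ b n (observedResponse β₀ x u c ω) (fun i => x i ω)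
        (isUncensored β₀ x u c ω) β₀ 0 <
      censoredMScale ρ b n (observedResponse β₀ x u c ω) (fun i => x i ω)
        (isUncensored β₀ x u c ω) β₀ γ := by
    intro ε hε
    obtain ⟨σ, hσ, hσle⟩ := h.exists_scale_le_meanErrorLoss hρ ha hb hD hG hs₀ hgt hε
    obtain ⟨s, hs1, hs2⟩ := exists_between hσ
    filter_upwards [hσle, h.ae_eventually_meanErrorLoss_zero_lt hρ ha hD (hs₀.trans hs1)
      (hlt₀ s hs1)] with ω h1 h2
    filter_upwards [h1, h2] with n h1 h2 γ hγ
    refine lt_of_le_of_lt (censoredMScale_le (hs₀.trans hs1) ?_) (hs2.trans_le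
      (le_censoredMScale hρ hb ?_))
    · rw [meanCensoredLoss_true_parameter]
      exact h2
    · rw [meanCensoredLoss_true_parameter]
      exact h1 γ hγ
  have key' : ∀ᵐ ω ∂P, ∀ k : ℕ, ∀ᶠ n in atTop, ∀ γ : EuclideanSpace ℝ (Fin p),
      1 / ((k : ℝ) + 1) ≤ ‖γ‖ →
      censoredMScale ρ b n (observedResponse β₀ x u c ω) (fun i => x i ω)
        (isUncensored β₀ x u c ω) β₀ 0 <
      censoredMScale ρ b n (observedResponse β₀ x u c ω) (fun i => x i ω)
        (isUncensored β₀ x u c ω) β₀ γ :=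
    ae_all_iff.2 fun k => key _ (by positivity)
  filter_upwards [key'] with ω hω
  refine ⟨?_, fun γ hγ => ?_⟩
  · filter_upwards [hω 0] with n hn
    obtain ⟨γ, hγ, hmin⟩ := LowerSemicontinuousOn.exists_isMinOn
      (s := Metric.closedBall (0 : EuclideanSpace ℝ (Fin p)) 1) ⟨0, by simp⟩
      (isCompact_closedBall 0 1)
      ((lowerSemicontinuous_censoredMScale (n := n) (y := observedResponse β₀ x u c ω)
        (x := fun i => x i ω) (δ := isUncensored β₀ x u c ω) (β := β₀) hρ
        hb).lowerSemicontinuousOn _)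
    refine ⟨γ, fun γ' => ?_⟩
    rcases le_total ‖γ'‖ 1 with hle | hle
    · exact hmin (by simpa using hle)
    · exact (hmin (by simp)).trans (hn γ' (by simpa using hle)).le
  · rw [Metric.tendsto_atTop']
    intro ε hε
    obtain ⟨k, hk⟩ := ((tendsto_div_natCast_add_one 1).eventually (gt_mem_nhds hε)).exists
    obtain ⟨N, hN⟩ := eventually_atTop.1 ((hω k).and hγ)
    refine ⟨N, fun n hn => ?_⟩
    obtain ⟨h1, h2⟩ := hN n hn.le
    rw [dist_zero_right]
    by_contra! hcon
    exact absurd (h2 0) (not_le.2 (h1 (γ n) (hk.le.trans hcon)))
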